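/- **Theorem (Algebraic Structure I).** Let $\mathscr P=\{\mathscr P_{n,\pm}\}_{n\ge 0}$ be a $C^*$-planar algebra, that is, a shaded planar $*$-algebra (in the sense of Jones) in which every box space $\mathscr P_{n,\pm}$ is, with the vertical multiplication ($ab$ has $a$ at the bottom and $b$ on top) and the reflection $*$, a finite-dimensional $C^*$-algebra, and which carries linear functionals $tr_{0,\pm}$ on $\mathscr P_{0,\pm}$ such that the traces $tr_{n,\pm}$, obtained by closing an $n$-box on the right and applying $tr_{0,\pm}$, are positive and faithful. Let $x\in\mathscr P_{2,\pm}$ be $\mathfrak F$-positive, i.e. its rotation by $90^\circ$, $\widehat x=\mathfrak F(x)\in\mathscr P_{2,\mp}$, is positive, and let $r$ be the spectral radius of $x$. Notation. A bar is the rotation by $180^\circ$; $a\otimes b\in\mathscr P_{2,\pm}$ is $a\in\mathscr P_{1,\pm}$ placed to the left of $b\in\mathscr P_{1,\mp}$; $\mathcal R(y)$ is the range projection of $y$. For $y\in\mathscr P_{1,\pm}$, $w\in\mathscr P_{2,\mp}$, the convolution $y*w\in\mathscr P_{1,\pm}$ is obtained by placing $y$ to the left of $w$ and joining the bottom and top points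 of $y$ with the bottom left and top left points of $w$; for $y_1\in\mathscr P_{1,\mp}$, $w*y_1\in\mathscr P_{1,\mp}$ is obtained by placing $y_1$ to the right of $w$ and joining its bottom and top points with the bottom right and top right points of $w$. Put $$\mathcal E^+=\{y\in\mathscr P_{1,\pm}:\ y\ge 0,\ y*\widehat x=ry\}.$$ A right PF eigenvector of $x$ is a nonzero positive $y_1\in\mathscr P_{1,\mp}$ with $\widehat x*y_1=ry_1$. Then the set $\{\mathcal R(y):y\in\mathcal E^+\}$ has a greatest element $p=p_{\max}$. With $x_p=(p\otimes\overline p)\,x\,(p\otimes\overline p)$, the series $\sum_{j\ge0}x_p^{\,j}/z^{j+1}$ converges for every real $z>r$, the limit $$y_p=\lim_{z\to r^+}(z-r)\sum_{j=0}^\infty \frac{x_p^{\,j}}{z^{j+1}}$$ exists, and we put $\zeta=p*\widehat{y_p}\in\mathscr P_{1,\pm}$. Let $$\mathcal A_p=\{v\in\mathscr P_{1,\pm}: x_p(1\otimes\overline v)=(1\otimes\overline v)x_p\},\qquad \mathcal B_p=\{v\in\mathscr P_{1,\pm}: x_p(v\otimes 1)=(v\otimes 1)x_p\}.$$ Suppose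 that $x$ has a right PF eigenvector $y_1\in\mathscr P_{1,\mp}$ such that $p\wedge\overline{\mathcal R(y_1)}^{\,\perp}=0$. Then $$\mathcal E^+=\{v\zeta v^*: v\in\mathcal A_p\}=\{v^*\zeta v: v\in\mathcal B_p\}.$$ -/

import Mathlib

open Filter Topology

universe u

/-- Shading of the region reached from a region of shading `ε` after crossing `i` strings.
The sign `+` (unshaded) is `true` and `-` (shaded) is `false`. -/
def shade (ε : Bool) (i : ℕ) : Bool := xor ε i.bodd

theorem shade_two_mul (ε : Bool) (n : ℕ) : shade ε (2 * n) = ε := by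
  simp [shade]

theorem shade_one (ε : Bool) : shade ε 1 = !ε := by
  cases ε <;> rfl

theorem shade_not_one (ε : Bool) : shade (!ε) 1 = ε := by
  cases ε <;> rfl

/-- The two operations that generate all shaded planar tangles from the boxes and the through-string.

`P n ε` is the space of `n`-boxes: discs with `2 * n` boundary points and a marked boundary interval
(the dollar sign) next to a region of shading `ε`. The boundary points are numbered `0, …, 2n - 1`
counterclockwise from the dollar sign. Drawn as a rectangle with the dollar sign on the left, an
`n`-box has the points `0, …, n - 1` at the bottom (left to right) and `n, …, 2n - 1` at the top
(right to left).

* `ins i a b` draws the box `b` beside `a`, with the dollar sign of `b` facing the region that lies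
  between the boundary points `i - 1` and `i` of `a`. For `i = 0` and for `i = 2 * m` this is the
  region of the dollar sign of `a`. The boundary points are, in order: the first `i` points of `a`,
  the points of `b`, the remaining points of `a`.
* `cap i a` joins the neighbouring boundary points `i` and `i + 1` of `a` by a string.

The total size `k` and the shading `δ` come with a proof of their value, so that no casts are
needed below. -/
structure PlanarOperations (P : ℕ → Bool → Type u)
    [∀ n ε, Ring (P n ε)] [∀ n ε, Algebra ℂ (P n ε)] where
  ins : ∀ {m n k : ℕ} {ε δ : Bool} (i : ℕ), i ≤ 2 * m → m + n = k → shade ε i = δ →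
    (P m ε →ₗ[ℂ] P n δ →ₗ[ℂ] P k ε)
  cap : ∀ {n : ℕ} {ε : Bool} (i : ℕ), i ≤ 2 * n → (P (n + 1) ε →ₗ[ℂ] P n ε)

namespace PlanarOperations

variable {P : ℕ → Bool → Type u} [∀ n ε, Ring (P n ε)] [∀ n ε, Algebra ℂ (P n ε)]
  (O : PlanarOperations P)

/-- `k` nested caps: the point `i + k - 1` is joined with `i + k`, then `i + k - 2` with
`i + k + 1`, and so on, until `i` is joined with `i + 2k - 1`. -/
def nest {n : ℕ} {ε : Bool} (i : ℕ) (hi : i ≤ 2 * n) : (k : ℕ) → (P (n + k) ε →ₗ[ℂ] P n ε)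
  | 0 => LinearMap.id
  | k + 1 => (nest i hi k).comp (O.cap (n := n + k) (i + k) (by omega))

/-- The bottom points of a box are connected with its top points by strings on the right. -/
def closure {ε : Bool} : (n : ℕ) → (P n ε →ₗ[ℂ] P 0 ε)
  | 0 => LinearMap.id
  | n + 1 => (closure n).comp (O.cap (n := n) n (by omega))

/-- The one-click rotation: the first boundary point of the box is led around the box by a string
(the unit of `P 1`) and becomes the last one. On `P 2` this is the Fourier transform, the rotation
by 90 degrees; on `P 1` it is the rotation by 180 degrees. -/
def rot {n : ℕ} {ε δ : Bool} (h : shade δ 1 = ε) : P (n + 1) ε →ₗ[ℂ] P (n + 1) δ :=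
  (O.cap 0 (by omega)).comp
    (O.ins (m := 1) (n := n + 1) (k := n + 1 + 1) 1 (by omega) (by omega) h (1 : P 1 δ))

end PlanarOperations

/-- A shaded planar `*`-algebra over `ℂ`: the operations `ins` and `cap` satisfy the relations
that express invariance under planar isotopy (they make the spaces of boxes, viewed as rectangles,
into a strict pivotal 2-category with two objects), multiplication is vertical composition, the
units of `P 0` and `P 1` are the empty diagram and the through-string, and `*` is the reflection
in a horizontal line. -/
structure PlanarStarAlgebra (P : ℕ → Bool → Type u)
    [∀ n ε, Ring (P n ε)] [∀ n ε, Algebra ℂ (P n ε)] [∀ n ε, StarRing (P n ε)]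
    [∀ n ε, StarModule ℂ (P n ε)]
    extends PlanarOperations P where
  /-- Inserting into the empty diagram. -/
  empty_ins : ∀ {n : ℕ} {ε : Bool} (h₁ : 0 ≤ 2 * 0) (h₂ : 0 + n = n) (h₃ : shade ε 0 = ε)
    (b : P n ε), ins 0 h₁ h₂ h₃ (1 : P 0 ε) b = b
  /-- Inserting the empty diagram. -/
  ins_empty : ∀ {m : ℕ} {ε δ : Bool} (i : ℕ) (h₁ : i ≤ 2 * m) (h₂ : m + 0 = m)
    (h₃ : shade ε i = δ) (a : P m ε), ins i h₁ h₂ h₃ a (1 : P 0 δ) = a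
  /-- Inserting `c` into `b` and `b` into `a` can be done in either order. -/
  ins_ins_nested : ∀ {m n l s t k : ℕ} {ε δ γ : Bool} (i j : ℕ)
    (hi : i ≤ 2 * m) (hj : j ≤ 2 * n) (hij : i + j ≤ 2 * s)
    (hs : m + n = s) (ht : n + l = t) (hk : m + t = k) (hk' : s + l = k)
    (hδ : shade ε i = δ) (hγ : shade δ j = γ) (hγ' : shade ε (i + j) = γ)
    (a : P m ε) (b : P n δ) (c : P l γ),
    ins i hi hk hδ a (ins j hj ht hγ b c) = ins (i + j) hij hk' hγ' (ins i hi hs hδ a b) c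
  /-- Inserting `b` and `c` at two places of `a` can be done in either order. -/
  ins_ins_parallel : ∀ {m n l s t k : ℕ} {ε δ γ : Bool} (i j : ℕ)
    (_ : i ≤ j) (hi : i ≤ 2 * m) (hj : j ≤ 2 * m) (hj' : j + 2 * n ≤ 2 * s) (hi' : i ≤ 2 * t)
    (hs : m + n = s) (ht : m + l = t) (hk : s + l = k) (hk' : t + n = k)
    (hδ : shade ε i = δ) (hγ : shade ε j = γ) (hγ' : shade ε (j + 2 * n) = γ)
    (a : P m ε) (b : P n δ) (c : P l γ),
    ins (j + 2 * n) hj' hk hγ' (ins i hi hs hδ a b) c = ins i hi' hk' hδ (ins j hj ht hγ a c) b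
  /-- Two disjoint caps can be made in either order. -/
  cap_cap : ∀ {n : ℕ} {ε : Bool} (i j : ℕ) (_ : i ≤ j) (hj : j ≤ 2 * n) (hi : i ≤ 2 * n)
    (hj' : j + 2 ≤ 2 * (n + 1)) (hi' : i ≤ 2 * (n + 1)) (x : P (n + 1 + 1) ε),
    cap i hi (cap (j + 2) hj' x) = cap j hj (cap i hi' x)
  /-- Capping `a` before the place where `b` is inserted. -/
  cap_ins_before : ∀ {m n k : ℕ} {ε δ : Bool} (i j : ℕ) (_ : j ≤ i) (hi : i ≤ 2 * m)
    (hi' : i + 2 ≤ 2 * (m + 1)) (hj : j ≤ 2 * m) (hj' : j ≤ 2 * k)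
    (hk : m + n = k) (hk' : m + 1 + n = k + 1) (hδ : shade ε i = δ) (hδ' : shade ε (i + 2) = δ)
    (a : P (m + 1) ε) (b : P n δ),
    cap j hj' (ins (i + 2) hi' hk' hδ' a b) = ins i hi hk hδ (cap j hj a) b
  /-- Capping the inserted box `b`. -/
  cap_ins_inside : ∀ {m n k : ℕ} {ε δ : Bool} (i j : ℕ) (hi : i ≤ 2 * m) (hj : j ≤ 2 * n)
    (hij : i + j ≤ 2 * k) (hk : m + n = k) (hk' : m + (n + 1) = k + 1) (hδ : shade ε i = δ)
    (a : P m ε) (b : P (n + 1) δ),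
    cap (i + j) hij (ins i hi hk' hδ a b) = ins i hi hk hδ a (cap j hj b)
  /-- Capping `a` after the place where `b` is inserted. -/
  cap_ins_after : ∀ {m n k : ℕ} {ε δ : Bool} (i j : ℕ) (_ : i ≤ j) (hj : j ≤ 2 * m)
    (hi : i ≤ 2 * m) (hi' : i ≤ 2 * (m + 1)) (hj' : j + 2 * n ≤ 2 * k)
    (hk : m + n = k) (hk' : m + 1 + n = k + 1) (hδ : shade ε i = δ)
    (a : P (m + 1) ε) (b : P n δ),
    cap (j + 2 * n) hj' (ins i hi' hk' hδ a b) = ins i hi hk hδ (cap j hj a) b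
  /-- Straightening a string attached to the boundary point `i` of `a`, first version. -/
  zigzag_left : ∀ {m : ℕ} {ε δ : Bool} (i : ℕ) (hi : i ≤ 2 * m) (hi' : i + 1 ≤ 2 * m)
    (hk : m + 1 = m + 1) (hδ : shade ε i = δ) (a : P m ε),
    cap (i + 1) hi' (ins i hi hk hδ a (1 : P 1 δ)) = a
  /-- Straightening a string attached to the boundary point `i` of `a`, second version. -/
  zigzag_right : ∀ {m : ℕ} {ε δ : Bool} (i : ℕ) (hi : i ≤ 2 * m) (hi' : i + 1 ≤ 2 * m)
    (hk : m + 1 = m + 1) (hδ : shade ε (i + 1) = δ) (a : P m ε),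
    cap i hi (ins (i + 1) hi' hk hδ a (1 : P 1 δ)) = a
  /-- The rotation by 360 degrees is trivial. -/
  rot_full : ∀ {n : ℕ} {ε : Bool} (x : P (n + 1) ε),
    (fun y : P (n + 1) ε =>
      toPlanarOperations.rot (shade_one ε)
        (toPlanarOperations.rot (shade_not_one ε) y))^[n + 1] x = x
  /-- The product `x * y` is vertical composition, with `x` at the bottom and `y` at the top. -/
  mul_eq : ∀ {n : ℕ} {ε : Bool} (x y : P n ε),
    x * y = toPlanarOperations.nest n (by omega) n
      (ins (2 * n) le_rfl rfl (shade_two_mul ε n) x y)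
  star_ins : ∀ {m n k : ℕ} {ε δ : Bool} (i j : ℕ) (_ : i + j = 2 * m)
    (hi : i ≤ 2 * m) (hj : j ≤ 2 * m) (hk : m + n = k) (hδ : shade ε i = δ) (hδ' : shade ε j = δ)
    (a : P m ε) (b : P n δ),
    star (ins i hi hk hδ a b) = ins j hj hk hδ' (star a) (star b)
  star_cap : ∀ {n : ℕ} {ε : Bool} (i j : ℕ) (_ : i + j = 2 * n) (hi : i ≤ 2 * n) (hj : j ≤ 2 * n)
    (a : P (n + 1) ε), star (cap i hi a) = cap j hj (star a)

/-- A `C*`-planar algebra: a shaded planar `*`-algebra whose box spaces are finite-dimensional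
`C*`-algebras, with linear functionals `tr₀` on the spaces of 0-boxes such that all the (unnormalized)
traces of `n`-boxes, obtained by connecting the bottom points with the top points on the right and
applying `tr₀`, are positive and faithful. -/
structure CStarPlanarAlgebra (P : ℕ → Bool → Type u) [∀ n ε, CStarAlgebra (P n ε)]
    extends PlanarStarAlgebra P where
  finiteDimensional : ∀ n ε, FiniteDimensional ℂ (P n ε)
  tr₀ : ∀ ε, P 0 ε →ₗ[ℂ] ℂ
  tr_nonneg : ∀ n ε (x : P n ε),
    0 ≤ (tr₀ ε (toPlanarOperations.closure n (x * star x))).re ∧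
      (tr₀ ε (toPlanarOperations.closure n (x * star x))).im = 0
  tr_faithful : ∀ n ε (x : P n ε),
    tr₀ ε (toPlanarOperations.closure n (x * star x)) = 0 → x = 0

/-- Positive elements of a `C*`-algebra. -/
def IsPos {A : Type u} [CStarAlgebra A] (a : A) : Prop := ∃ b : A, a = b * star b

/-- `q` is the range projection of `y`: the smallest projection with `q * y = y`
(for projections, `e ≤ f` means `f * e = e`). -/
def IsRangeProjection {A : Type u} [CStarAlgebra A] (y q : A) : Prop :=
  IsStarProjection q ∧ q * y = y ∧ ∀ f : A, IsStarProjection f → f * y = y → f * q = q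

/-- `g` is the infimum of the projections `e` and `f` among projections. -/
def IsProjectionInf {A : Type u} [CStarAlgebra A] (e f g : A) : Prop :=
  IsStarProjection g ∧ e * g = g ∧ f * g = g ∧
    ∀ h : A, IsStarProjection h → e * h = h → f * h = h → g * h = h

namespace CStarPlanarAlgebra

variable {P : ℕ → Bool → Type u} [∀ n ε, CStarAlgebra (P n ε)] (pa : CStarPlanarAlgebra P)
  {ε : Bool}

/-- The Fourier transform of a 2-box: the one-click rotation, i.e. the rotation by 90 degrees. -/
noncomputable def fourier (x : P 2 ε) : P 2 (!ε) :=
  pa.rot (shade_not_one ε) x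

/-- The rotation by 180 degrees of a 1-box. -/
noncomputable def bar (y : P 1 ε) : P 1 (!ε) :=
  pa.rot (shade_not_one ε) y

/-- The rotation by 180 degrees, from the 1-boxes of the opposite shading. -/
noncomputable def bar' (y : P 1 (!ε)) : P 1 ε :=
  pa.rot (shade_one ε) y

/-- The 2-box consisting of `a` on the left string and `b` on the right string. -/
noncomputable def tensor (a : P 1 ε) (b : P 1 (!ε)) : P 2 ε :=
  pa.ins (m := 1) (n := 1) (k := 2) 1 (by omega) rfl (shade_one ε) a b

/-- The convolution `y ∗ w` of a 1-box `y` with a 2-box `w` on its right: the bottom and the top of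
`y` are joined with the bottom left and the top left point of `w`. -/
noncomputable def convLeft (y : P 1 ε) (w : P 2 (!ε)) : P 1 ε :=
  pa.cap (n := 1) 0 (by omega) (pa.cap (n := 2) 4 (by omega)
    (pa.ins (m := 1) (n := 2) (k := 3) 1 (by omega) rfl (shade_one ε) y w))

/-- The convolution `w ∗ y` of a 2-box `w` with a 1-box `y` on its right: the bottom and the top of
`y` are joined with the bottom right and the top right point of `w`. -/
noncomputable def convRight (w : P 2 (!ε)) (y : P 1 (!ε)) : P 1 (!ε) :=
  pa.cap (n := 1) 1 (by omega) (pa.cap (n := 2) 1 (by omega)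
    (pa.ins (m := 2) (n := 1) (k := 3) 2 (by omega) rfl (shade_two_mul (!ε) 1) w y))

/-- `x` is `𝔉`-positive. -/
def FPositive (x : P 2 ε) : Prop := IsPos (pa.fourier x)

/-- The spectral radius of a 2-box. -/
noncomputable def specRad (x : P 2 ε) : ℝ := (spectralRadius ℂ x).toReal

/-- The set `ℰ⁺` of positive elements of the Perron-Frobenius eigenspace
`ℰ = {y | y ∗ 𝔉(x) = r y}`. -/
def posEigenvectors (x : P 2 ε) : Set (P 1 ε) :=
  {y | IsPos y ∧ pa.convLeft y (pa.fourier x) = ((specRad x : ℝ) : ℂ) • y}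

/-- A right Perron-Frobenius eigenvector of `x`. -/
def IsRightPFEigenvector (x : P 2 ε) (y : P 1 (!ε)) : Prop :=
  y ≠ 0 ∧ IsPos y ∧ pa.convRight (pa.fourier x) y = ((specRad x : ℝ) : ℂ) • y

/-- `p` is the largest among the range projections of the elements of `ℰ⁺`. -/
def IsMaxProjection (x : P 2 ε) (p : P 1 ε) : Prop :=
  (∃ y ∈ pa.posEigenvectors x, IsRangeProjection y p) ∧
    ∀ y ∈ pa.posEigenvectors x, ∀ q : P 1 ε, IsRangeProjection y q → p * q = q

/-- The cut-down of `x` by `p ⊗ p̄`. -/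
noncomputable def cutDown (x : P 2 ε) (p : P 1 ε) : P 2 ε :=
  pa.tensor p (pa.bar p) * x * pa.tensor p (pa.bar p)

/-- `ζ = p ∗ 𝔉(y_p)`, where `y_p = lim_{z → r⁺} (z - r) ∑ⱼ (x_p)ʲ / zʲ⁺¹` and `x_p` is the cut-down
of `x` by `p`. -/
def IsMaxSupportEigenvector (x : P 2 ε) (p ζ : P 1 ε) : Prop :=
  ∃ (S : ℝ → P 2 ε) (yp : P 2 ε),
    (∀ z : ℝ, specRad x < z →
      HasSum (fun j : ℕ => ((z : ℂ) ^ (j + 1))⁻¹ • (pa.cutDown x p) ^ j) (S z)) ∧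
    Tendsto (fun z : ℝ => ((z - specRad x : ℝ) : ℂ) • S z) (𝓝[>] (specRad x)) (𝓝 yp) ∧
    ζ = pa.convLeft p (pa.fourier yp)

/-- The exchange algebra `𝒜` of a 2-box: `ȳ` can be moved along the right string of `x`. -/
def exchangeA (x : P 2 ε) : Set (P 1 ε) :=
  {y | x * pa.tensor 1 (pa.bar y) = pa.tensor 1 (pa.bar y) * x}

/-- The exchange algebra `ℬ` of a 2-box: `y` can be moved along the left string of `x`. -/
def exchangeB (x : P 2 ε) : Set (P 1 ε) :=
  {y | x * pa.tensor y 1 = pa.tensor y 1 * x}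

end CStarPlanarAlgebra

/-! Write `Φ(y) = y ∗ x̂`; in the code this is `act x y`, and products of 2-boxes become composites
of such maps. With `L` and `R` for 1-boxes on the left and right leg of a rotated 2-box (`leftLeg`,
`rightLeg`), `Φ(y)` is `L(y) x̂` with the left string closed. This partial closure is positive and
faithful, so `Φ` is a positive map and `ℰ⁺` consists of its positive eigenvectors for `r`.

Support. A sum of elements of `ℰ⁺` is in `ℰ⁺`, so an element `y₀` of maximal rank has the largest
support `p`. Positive elements of the corner of `p` are dominated by multiples of `y₀`; hence `Φ`
preserves the corner and agrees there with the map of `x_p`. Rotation turns products into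
convolutions, which preserve positivity (a Schur product theorem, `conv_nonneg`). For `r > 0`,
comparison with `1 ⊗ y₀` gives `‖x_p ^ j‖ ≤ C r ^ j` (`exists_norm_corner_pow_le`), and in finite
dimension this forces the Abel limit to exist (`exists_tendsto_abel_mean`); for `r = 0`, `x_p = 0`.
The resulting `ζ` is an eigenvector with support exactly `p`, so it is invertible in the corner.

Exchange. For `y ∈ ℰ⁺` put `d = y ζ⁻¹`, `z = y ζ⁻¹ y` and `U = L(ζ^{1/2}) (L(d) - R(d))`. Closing
the left string of `U x̂ U*` gives `Φ(z) - r z`, which is therefore positive. The right eigenvector,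
rotated, defines a trace functional that `Φ` multiplies by `r`; it kills `Φ(z) - r z` and is
faithful on positive elements below `p`. So `U x̂ = 0`, which makes `d` exchangeable for `x_p`
(`exchange_of_eigenvector`). Exchangeable elements form an algebra, so it contains `v = ζ^{1/2}
(ζ^{-1/2} y ζ^{-1/2})^{1/2} ζ^{-1/2}`, because the inner square root is a polynomial; and `v ζ v* =
y`.

Conversely an exchangeable `v` passes through the map of `x_p`, so `v ζ v*` is an eigenvector if `r
> 0`. If `r = 0` then `x` is nilpotent, and the functional forces `Φ` to vanish on positive
elements. The description by `ℬ_p` follows by taking adjoints. -/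

theorem shade_eq_of_bodd_eq_false {ε : Bool} {i : ℕ} (hi : i.bodd = false) : shade ε i = ε := by
  simp [shade, hi]

theorem shade_eq_of_bodd_eq_true {ε δ : Bool} (h : shade ε 1 = δ) {i : ℕ} (hi : i.bodd = true) :
    shade ε i = δ := by
  rw [← h]; simp [shade, hi]

theorem shade_one_symm {ε δ : Bool} (h : shade ε 1 = δ) : shade δ 1 = ε := by
  cases ε <;> cases δ <;> simp_all [shade]

theorem shade_shade (ε : Bool) (i j : ℕ) : shade (shade ε i) j = shade ε (i + j) := by
  simp [shade]

/-! ### Planar calculus: normal forms of diagrams, rotations, convolutions -/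

namespace PlanarStarAlgebra

variable {P : ℕ → Bool → Type u} [∀ n ε, Ring (P n ε)] [∀ n ε, Algebra ℂ (P n ε)]
  [∀ n ε, StarRing (P n ε)] [∀ n ε, StarModule ℂ (P n ε)] (O : PlanarStarAlgebra P)
  {ε δ γ : Bool}

/-- This and the next rewriting rules move caps outwards, order them, and nest insertions to the
left. Isotopic diagrams can then be compared by normal form, once a zigzag has been inserted
wherever a string has to be bent. -/
theorem ins_cap_right {m n k i j : ℕ} (hi : i ≤ 2 * m) (hj : j ≤ 2 * n) (hk : m + n = k)
    (hδ : shade ε i = δ) (a : P m ε) (b : P (n + 1) δ) :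
    O.ins i hi hk hδ a (O.cap j hj b) =
      O.cap (i + j) (by omega) (O.ins (k := k + 1) i hi (by omega) hδ a b) :=
  (O.cap_ins_inside i j hi hj _ hk _ hδ a b).symm

theorem ins_cap_left_before {m n k i j : ℕ} (hi : i ≤ 2 * m) (hj : j ≤ 2 * m) (hk : m + n = k)
    (hδ : shade ε i = δ) (hij : j < i) (a : P (m + 1) ε) (b : P n δ) :
    O.ins i hi hk hδ (O.cap j hj a) b =
      O.cap j (by omega) (O.ins (k := k + 1) (i + 2) (by omega) (by omega)
        (by rw [← hδ]; simp [shade]) a b) :=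
  (O.cap_ins_before i j hij.le hi _ hj _ hk _ hδ _ a b).symm

theorem ins_cap_left_after {m n k i j : ℕ} (hi : i ≤ 2 * m) (hj : j ≤ 2 * m) (hk : m + n = k)
    (hδ : shade ε i = δ) (hij : i ≤ j) (a : P (m + 1) ε) (b : P n δ) :
    O.ins i hi hk hδ (O.cap j hj a) b =
      O.cap (j + 2 * n) (by omega) (O.ins (k := k + 1) i (by omega) (by omega) hδ a b) :=
  (O.cap_ins_after i j hij hj hi _ _ hk _ hδ a b).symm

theorem ins_ins_right {m n l t k i j : ℕ} (hi : i ≤ 2 * m) (hj : j ≤ 2 * n)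
    (ht : n + l = t) (hk : m + t = k) (hδ : shade ε i = δ) (hγ : shade δ j = γ)
    (a : P m ε) (b : P n δ) (c : P l γ) :
    O.ins i hi hk hδ a (O.ins j hj ht hγ b c) =
      O.ins (i + j) (by omega) (by omega) (by rw [← hγ, ← hδ, shade_shade])
        (O.ins (k := m + n) i hi rfl hδ a b) c :=
  O.ins_ins_nested i j hi hj _ rfl ht hk _ hδ hγ _ a b c

theorem cap_cap_of_le {n i j : ℕ} (hi : i ≤ 2 * n) (hj : j ≤ 2 * (n + 1)) (hij : i + 2 ≤ j)
    (x : P (n + 1 + 1) ε) :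
    O.cap i hi (O.cap j hj x) = O.cap (j - 2) (by omega) (O.cap i (by omega) x) := by
  obtain ⟨j, rfl⟩ := Nat.exists_eq_add_of_le' (show 2 ≤ j by omega)
  exact O.cap_cap i j (by omega) (by omega) hi hj _ x

/-- Once the points `j` and `j + 1` are joined, the regions before and after them are the same, so
`b` may sit in either; the normal form takes the earlier place. -/
theorem cap_ins_slide {m n k i j : ℕ} (hj : j ≤ 2 * k) (hi : i ≤ 2 * (m + 1))
    (hk : m + 1 + n = k + 1) (hδ : shade ε i = δ) (hij : i = j + 2)
    (a : P (m + 1) ε) (b : P n δ) :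
    O.cap j hj (O.ins i hi hk hδ a b) =
      O.cap (j + 2 * n) (by omega) (O.ins (k := k + 1) j (by omega) hk
        (by rw [← hδ, hij]; simp [shade]) a b) := by
  subst hij
  have hδ' : shade ε j = δ := by rw [← hδ]; simp [shade]
  rw [O.cap_ins_before j j le_rfl (by omega) hi (by omega) hj (by omega) hk hδ' hδ,
    O.cap_ins_after j j le_rfl (by omega) (by omega)]

theorem one_box_mul (a b : P 1 ε) :
    a * b = O.cap (n := 1) 1 (by omega)
      (O.ins (m := 1) (n := 1) (k := 2) 2 (by omega) rfl (shade_two_mul ε 1) a b) :=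
  O.mul_eq a b

theorem two_box_mul (a b : P 2 ε) :
    a * b = O.cap (n := 2) 2 (by omega) (O.cap (n := 3) 3 (by omega)
      (O.ins (m := 2) (n := 2) (k := 4) 4 (by omega) rfl (shade_two_mul ε 2) a b)) :=
  O.mul_eq a b

theorem three_box_mul (a b : P 3 ε) :
    a * b = O.cap (n := 3) 3 (by omega) (O.cap (n := 4) 4 (by omega) (O.cap (n := 5) 5 (by omega)
      (O.ins (m := 3) (n := 3) (k := 6) 6 (by omega) rfl (shade_two_mul ε 3) a b))) :=
  O.mul_eq a b

/-- The 1-box `y` is composed with the bottom of the 2-box `x`. -/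
def act (x : P 2 ε) (y : P 1 ε) : P 1 ε :=
  O.cap (n := 1) 0 (by omega) (O.cap (n := 2) 1 (by omega)
    (O.ins (m := 1) (n := 2) (k := 3) 2 (by omega) rfl (shade_two_mul ε 1) y x))

attribute [local simp] ins_cap_right ins_cap_left_before ins_cap_left_after ins_ins_right
  cap_cap_of_le cap_ins_slide

theorem ins_ins_swap {m n l s k i j : ℕ} (hj : j ≤ 2 * s) (hi : i ≤ 2 * m)
    (hs : m + n = s) (hk : s + l = k) (hδ : shade ε i = δ) (hγ : shade ε j = γ)
    (hij : i + 2 * n ≤ j) (a : P m ε) (b : P n δ) (c : P l γ) :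
    O.ins j hj hk hγ (O.ins i hi hs hδ a b) c =
      O.ins i (by omega) (by omega) hδ
        (O.ins (k := m + l) (j - 2 * n) (by omega) rfl
          (by rw [← hγ, ← Nat.sub_add_cancel (show 2 * n ≤ j by omega)]; simp [shade]) a c) b := by
  obtain ⟨j, rfl⟩ := Nat.exists_eq_add_of_le' (show 2 * n ≤ j by omega)
  simp only [Nat.add_sub_cancel]
  exact O.ins_ins_parallel i j (by omega) hi (by omega) _ _ hs rfl hk _ hδ _ hγ a b c

/-- Both boxes are parallel insertions into the empty diagram, so either one may be regarded as the
host. -/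
theorem ins_zero {m n k : ℕ} (hm : 0 ≤ 2 * m) (hk : m + n = k) (h0 : shade ε 0 = ε)
    (hk' : n + m = k)
    (a : P m ε) (b : P n ε) :
    O.ins 0 hm hk h0 a b = O.ins (2 * n) le_rfl hk' (shade_two_mul ε n) b a := by
  have := O.ins_ins_parallel (m := 0) (n := n) (l := m) (s := n) (t := m) (k := k)
    0 0 le_rfl (by omega) (by omega) (by omega) (by omega) (by omega) (by omega) hk' hk
    h0 h0 (by simp [shade]) (1 : P 0 ε) b a
  rw [O.empty_ins, O.empty_ins] at this
  rw [← this]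
  simp only [Nat.zero_add]

theorem zigzag_ins_one_left {m : ℕ} (h1 : 1 ≤ 2 * (m + 1)) (h2 : 2 ≤ 2 * 1)
    (hk : 1 + (m + 1) = m + 1 + 1) (hδ : shade ε 2 = ε) (a : P (m + 1) ε) :
    O.cap 1 h1 (O.ins 2 h2 hk hδ (1 : P 1 ε) a) = a := by
  have h0 : shade ε 0 = ε := shade_eq_of_bodd_eq_false rfl
  calc _ = O.cap 1 h1 (O.ins 0 (by omega) rfl h0 a (1 : P 1 ε)) := by rw [O.ins_zero _ rfl h0 hk]
    _ = a := O.zigzag_left 0 _ h1 rfl h0 a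

/-- The 2-box consisting of `a` on the left string and `b` on the right string. -/
def juxt (h : shade ε 1 = δ) (a : P 1 ε) (b : P 1 δ) : P 2 ε :=
  O.ins (m := 1) (n := 1) (k := 2) 1 (by omega) rfl h a b

theorem juxt_mul (h : shade ε 1 = δ) (a : P 1 ε) (b : P 1 δ) (z : P 2 ε) :
    O.juxt h a b * z = O.cap (n := 2) 2 (by omega)
      (O.ins (m := 2) (n := 1) (k := 3) 1 (by omega) rfl h
        (O.cap (n := 2) 1 (by omega)
          (O.ins (m := 1) (n := 2) (k := 3) 2 (by omega) rfl (shade_two_mul ε 1) a z)) b) := by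
  simp [juxt, O.two_box_mul, ins_ins_swap]

theorem mul_juxt (h : shade ε 1 = δ) (a : P 1 ε) (b : P 1 δ) (z : P 2 ε) :
    z * O.juxt h a b = O.cap (n := 2) 2 (by omega)
      (O.ins (m := 2) (n := 1) (k := 3) 3 (by omega) rfl (shade_eq_of_bodd_eq_true h rfl)
        (O.cap (n := 2) 3 (by omega)
          (O.ins (m := 2) (n := 1) (k := 3) 4 (by omega) rfl (shade_two_mul ε 2) z a)) b) := by
  simp [juxt, O.two_box_mul]

theorem juxt_mul_juxt (h : shade ε 1 = δ) (a c : P 1 ε) (b d : P 1 δ) :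
    O.juxt h a b * O.juxt h c d = O.juxt h (a * c) (b * d) := by
  rw [O.two_box_mul]
  simp only [juxt]
  rw [ins_ins_right, O.ins_ins_swap (j := 4) (i := 1) _ _ _ _ _ _ (by omega)]
  simp [O.one_box_mul]

theorem juxt_one_left_mul (h : shade ε 1 = δ) (b : P 1 δ) (z : P 2 ε) :
    O.juxt h 1 b * z = O.cap (n := 2) 2 (by omega)
      (O.ins (m := 2) (n := 1) (k := 3) 1 (by omega) rfl h z b) := by
  rw [juxt_mul]
  congr 3
  exact O.zigzag_ins_one_left _ _ _ _ z

theorem juxt_one_right_mul (h : shade ε 1 = δ) (a : P 1 ε) (z : P 2 ε) :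
    O.juxt h a 1 * z = O.cap (n := 2) 1 (by omega)
          (O.ins (m := 1) (n := 2) (k := 3) 2 (by omega) rfl (shade_two_mul ε 1) a z) := by
  rw [juxt_mul]
  exact O.zigzag_left 1 _ _ _ _ _

theorem mul_juxt_one_left (h : shade ε 1 = δ) (b : P 1 δ) (z : P 2 ε) :
    z * O.juxt h 1 b = O.cap (n := 2) 2 (by omega)
      (O.ins (m := 2) (n := 1) (k := 3) 3 (by omega) rfl (shade_eq_of_bodd_eq_true h rfl) z b) := by
  rw [mul_juxt]
  congr 3
  exact O.zigzag_right 3 _ _ _ _ _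

theorem mul_juxt_one_right (h : shade ε 1 = δ) (a : P 1 ε) (z : P 2 ε) :
    z * O.juxt h a 1 = O.cap (n := 2) 3 (by omega)
          (O.ins (m := 2) (n := 1) (k := 3) 4 (by omega) rfl (shade_two_mul ε 2) z a) := by
  rw [mul_juxt]
  exact O.zigzag_right 2 _ _ _ _ _

theorem juxt_one_one (h : shade ε 1 = δ) : O.juxt h 1 1 = 1 := by
  rw [← mul_one (O.juxt h 1 1), juxt_one_right_mul]
  exact O.zigzag_ins_one_left _ _ _ _ _

theorem star_juxt (h : shade ε 1 = δ) (a : P 1 ε) (b : P 1 δ) :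
    star (O.juxt h a b) = O.juxt h (star a) (star b) :=
  O.star_ins 1 1 rfl _ _ _ _ _ _ _

/-- The inverse of the one-click rotation. -/
def rotInv {n : ℕ} (h : shade δ 1 = ε) : P (n + 1) ε →ₗ[ℂ] P (n + 1) δ :=
  (O.cap (2 * (n + 1)) (by omega)).comp
    (O.ins (m := 1) (n := n + 1) (k := n + 1 + 1) 1 (by omega) (by omega) h (1 : P 1 δ))

theorem rot_apply {n : ℕ} (h : shade δ 1 = ε) (x : P (n + 1) ε) : O.rot h x = O.cap 0 (by omega)
    (O.ins (m := 1) (n := n + 1) (k := n + 1 + 1) 1 (by omega) (by omega) h (1 : P 1 δ) x) := rfl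

theorem rotInv_apply {n : ℕ} (h : shade δ 1 = ε) (x : P (n + 1) ε) :
    O.rotInv h x = O.cap (2 * (n + 1)) (by omega)
    (O.ins (m := 1) (n := n + 1) (k := n + 1 + 1) 1 (by omega) (by omega) h (1 : P 1 δ) x) := rfl

theorem star_rot {n : ℕ} (h : shade δ 1 = ε) (x : P (n + 1) ε) :
    star (O.rot h x) = O.rotInv h (star x) := by
  rw [rot_apply, rotInv_apply, O.star_cap 0 (2 * (n + 1)) (by omega) _ (by omega),
    O.star_ins 1 1 rfl _ (by omega) _ h h, star_one]

theorem rotInv_rot {n : ℕ} (h : shade δ 1 = ε) (h' : shade ε 1 = δ) (x : P (n + 1) ε) :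
    O.rotInv h' (O.rot h x) = x := by
  rw [rot_apply, rotInv_apply, ins_cap_right, ins_ins_right]
  simp only [Nat.add_zero, Nat.reduceAdd]
  rw [← O.cap_cap 1 (2 * (n + 1)) (by omega) (by omega) (by omega) (by omega) (by omega)]
  calc _ = O.cap (n := n + 1) 1 (by omega) (O.ins (m := 1) (n := n + 1)
        (k := n + 1 + 1) 2 (by omega)
        (by omega) (shade_eq_of_bodd_eq_false rfl)
        (O.cap 2 (by omega) (O.ins (k := 2) 1 (by omega) rfl h' (1 : P 1 ε) (1 : P 1 δ))) x) := by
        rw [ins_cap_left_after _ _ _ _ _ le_rfl]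
        simp only [Nat.add_comm 2]
    _ = x := by
      rw [O.zigzag_left 1]
      exact O.zigzag_ins_one_left _ _ _ _ x

/-- The rotation has finite order, hence is surjective, so its left inverse is two-sided. -/
theorem rot_rotInv {n : ℕ} (h : shade δ 1 = ε) (h' : shade ε 1 = δ) (x : P (n + 1) ε) :
    O.rot h' (O.rotInv h x) = x := by
  obtain rfl : δ = !ε := by rw [← h', shade_one]
  have hx := O.rot_full x
  rw [Function.iterate_succ_apply'] at hx
  rw [← hx, rotInv_rot]

theorem cap_ins_eq_rot_mul (h : shade ε 1 = δ) (c : P 1 ε) (b : P 1 δ) :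
    O.cap (n := 1) 0 (by omega) (O.ins (m := 1) (n := 1) (k := 2) 1 (by omega) rfl h c b) =
      O.rot h b * c := by
  conv_lhs => rw [← one_mul c]
  simp [rot_apply, O.one_box_mul, ins_ins_swap]

theorem cap_ins_eq_mul_rotInv (h : shade ε 1 = δ) (c : P 1 ε) (b : P 1 δ) :
    O.cap (n := 1) 2 (by omega) (O.ins (m := 1) (n := 1) (k := 2) 1 (by omega) rfl h c b) =
      c * O.rotInv h b := by
  conv_lhs => rw [← mul_one c]
  simp [rotInv_apply, O.one_box_mul]

theorem rot_rot (h : shade δ 1 = ε) (h' : shade ε 1 = δ) (x : P 1 ε) :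
    O.rot (n := 0) h' (O.rot (n := 0) h x) = x := by
  obtain rfl : δ = !ε := by rw [← h', shade_one]
  exact O.rot_full (n := 0) x

theorem rotInv_eq_rot (h : shade δ 1 = ε) (x : P 1 ε) :
    O.rotInv (n := 0) h x = O.rot (n := 0) h x := by
  conv_lhs => rw [← O.rot_rot h (shade_one_symm h) x, rotInv_rot]

theorem rot_one (h : shade δ 1 = ε) : O.rot (n := 0) h 1 = 1 := by
  rw [rot_apply]
  exact O.zigzag_right 0 _ _ _ _ _

theorem star_rot_one_box (h : shade δ 1 = ε) (x : P 1 ε) :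
    star (O.rot (n := 0) h x) = O.rot (n := 0) h (star x) := by
  rw [star_rot, rotInv_eq_rot]

/-- The string at the point `i` of `w` can be prolonged by a 1-box attached on either of its sides;
changing sides turns the box by 180 degrees. -/
theorem cap_ins_rot (m i : ℕ) (hi : i + 1 ≤ 2 * m) (h : shade ε i = δ) (h' : shade ε (i + 1) = γ)
    (hγ : shade δ 1 = γ) (w : P m ε) (d : P 1 γ) :
    O.cap i (by omega) (O.ins (i + 1) hi rfl h' w d) =
      O.cap (i + 1) hi (O.ins i (by omega) rfl h w (O.rot (n := 0) hγ d)) := by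
  rw [rot_apply, ins_cap_right, ins_ins_right]
  simp only [Nat.add_zero]
  rw [← O.cap_cap i (i + 1) (by omega) (by omega) (by omega) (by omega) (by omega)]
  congr 1
  calc _ = O.ins (i + 1) hi rfl h' (O.cap (i + 1) (by omega) (O.ins i (by omega) rfl h w (1 : P 1 δ)))
        d := by
        rw [O.zigzag_left i]
    _ = _ := by
        rw [ins_cap_left_after _ _ _ _ _ le_rfl]

theorem rot_juxt_one_left_mul (h : shade δ 1 = ε) (h' : shade ε 1 = δ) (b : P 1 δ) (z : P 2 ε) :
    O.rot h (O.juxt h' 1 b * z) = O.juxt h b 1 * O.rot h z := by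
  rw [juxt_one_left_mul, juxt_one_right_mul]
  have h0 : shade δ 0 = δ := shade_eq_of_bodd_eq_false rfl
  calc _ = O.cap (n := 2) 1 (by omega)
        (O.ins (k := 3) 0 (by omega) rfl h0 (O.rot (n := 1) h z) b) := by
        simp [rot_apply]
    _ = _ := by rw [O.ins_zero _ _ _ rfl]

theorem rot_mul_juxt_one_left (h : shade δ 1 = ε) (h' : shade ε 1 = δ) (d : P 1 δ) (z : P 2 ε) :
    O.rot h (z * O.juxt h' 1 d) = O.juxt h 1 (O.rot (n := 0) h' d) * O.rot h z := by
  rw [mul_juxt_one_left, juxt_one_left_mul,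
    ← O.cap_ins_rot 2 1 _ _ (shade_eq_of_bodd_eq_false rfl)]
  simp [rot_apply]

theorem rot_mul_juxt_one_right (h : shade δ 1 = ε) (h' : shade ε 1 = δ) (c : P 1 ε) (z : P 2 ε) :
    O.rot h (z * O.juxt h' c 1) = O.rot h z * O.juxt h 1 c := by
  rw [mul_juxt_one_right, mul_juxt_one_left]
  simp [rot_apply]

theorem rot_juxt_one_right_mul (h : shade δ 1 = ε) (h' : shade ε 1 = δ) (a : P 1 ε) (z : P 2 ε) :
    O.rot h (O.juxt h' a 1 * z) = O.rot h z * O.juxt h (O.rot (n := 0) h a) 1 := by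
  rw [juxt_one_right_mul, mul_juxt_one_right]
  calc _ = O.cap (n := 2) 0 (by omega) (O.ins (m := 1) (n := 2) (k := 3) 1 (by omega) rfl h
        (1 * O.rot (n := 0) h a) z) := by
        rw [one_mul]
        simp [rot_apply]
    _ = _ := by
        simp [rot_apply, O.one_box_mul, ins_ins_swap]

theorem rot_mul (h : shade ε 1 = δ) (a b : P 1 δ) :
    O.rot (n := 0) h (a * b) = O.rot (n := 0) h b * O.rot (n := 0) h a := by
  rw [← cap_ins_eq_rot_mul]
  simp [rot_apply, O.one_box_mul, ins_ins_swap]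

theorem act_mul (a b : P 2 ε) (y : P 1 ε) : O.act (a * b) y = O.act b (O.act a y) := by
  simp [act, O.two_box_mul]

theorem act_juxt (h : shade ε 1 = δ) (a : P 1 ε) (b : P 1 δ) (y : P 1 ε) :
    O.act (O.juxt h a b) y = O.rot (n := 0) h b * (y * a) := by
  rw [← cap_ins_eq_rot_mul]
  simp [act, juxt, O.one_box_mul]

/-- The convolution of 2-boxes: the right points of `z` are joined with the left points of `w`. -/
def conv (z w : P 2 ε) : P 2 ε :=
  O.cap (n := 2) 1 (by omega) (O.cap (n := 3) 5 (by omega)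
    (O.ins (m := 2) (n := 2) (k := 4) 2 (by omega) rfl (shade_two_mul ε 1) z w))

/-- The right string of a 2-box is closed on the left. -/
def closeLeft (h : shade ε 1 = δ) : P 2 δ →ₗ[ℂ] P 1 ε :=
  (O.cap (n := 1) 0 (by omega)).comp (O.rotInv h)

theorem closeLeft_apply (h : shade ε 1 = δ) (w : P 2 δ) :
    O.closeLeft h w = O.cap (n := 1) 0 (by omega) (O.rotInv h w) := rfl

/-- This lets powers of a 2-box be estimated through convolution powers of its rotation, where
positivity is available. -/
theorem conv_rot_rot (h : shade δ 1 = ε) (a x : P 2 ε) :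
    O.conv (O.rot h a) (O.rot h x) = O.rot h (a * x) := by
  calc _ = O.cap (n := 2) 1 (by omega) (O.cap (n := 3) 2 (by omega)
        (O.ins (m := 2) (n := 2) (k := 4) 3 (by omega) rfl (shade_eq_of_bodd_eq_true h rfl)
          (O.cap (n := 2) 3 (by omega) (O.ins (m := 2) (n := 1) (k := 3) 2 (by omega) rfl
            (shade_two_mul δ 1) (O.rot (n := 1) h a) 1)) x)) := by
        rw [O.rot_apply h x, conv]
        generalize O.rot (n := 1) h a = z
        simp
    _ = _ := by
        rw [O.zigzag_left 2]
        simp [rot_apply, O.two_box_mul]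

theorem closure_closeLeft_mul (h : shade ε 1 = δ) (a b : P 2 δ) :
    O.closure 1 (O.closeLeft h (a * b)) = O.closure 2 (O.rot h a * O.rotInv h b) := by
  calc _ = O.cap (n := 0) 0 (by omega) (O.cap (n := 1) 1 (by omega) (O.cap (n := 2) 2 (by omega)
        (O.cap (n := 3) 6 (by omega)
        (O.ins (m := 2) (n := 2) (k := 4) 3 (by omega) rfl (shade_eq_of_bodd_eq_true h rfl)
          (O.rot (n := 1) h a) b)))) := by
        simp [closeLeft_apply, PlanarOperations.closure, rotInv_apply, rot_apply, O.two_box_mul]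
    _ = O.cap (n := 0) 0 (by omega) (O.cap (n := 1) 1 (by omega) (O.cap (n := 2) 2 (by omega)
        (O.cap (n := 3) 6 (by omega)
        (O.ins (m := 2) (n := 2) (k := 4) 3 (by omega) rfl (shade_eq_of_bodd_eq_true h rfl)
          (O.cap (n := 2) 3 (by omega) (O.ins (m := 2) (n := 1) (k := 3) 4 (by omega) rfl
            (shade_two_mul ε 2) (O.rot (n := 1) h a) 1)) b)))) := by
        rw [O.zigzag_right 3]
    _ = _ := by
        generalize O.rot (n := 1) h a = z
        simp [PlanarOperations.closure, rotInv_apply, O.two_box_mul]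

theorem convolution_rot (h : shade ε 1 = δ) (h' : shade δ 1 = ε) (y : P 1 ε) (x : P 2 ε) :
    O.cap (n := 1) 0 (by omega) (O.cap (n := 2) 4 (by omega)
      (O.ins (m := 1) (n := 2) (k := 3) 1 (by omega) rfl h y (O.rot (n := 1) h' x))) =
      O.act x y := by
  calc _ = O.cap (n := 1) 0 (by omega) (O.cap (n := 2) 1 (by omega)
      (O.ins (m := 1) (n := 2) (k := 3) 2 (by omega) rfl (shade_two_mul ε 1)
       (O.cap (n := 1) 2 (by omega) (O.ins (m := 1) (n := 1) (k := 2) 1 (by omega) rfl h y 1))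
        x)) := by
        simp [rot_apply]
    _ = _ := by rw [O.zigzag_left 1]; rfl

theorem rot_convolution (h' : shade δ 1 = ε) (x : P 2 ε) (y : P 1 ε) :
    O.cap (n := 1) 1 (by omega) (O.cap (n := 2) 1 (by omega)
      (O.ins (m := 2) (n := 1) (k := 3) 2 (by omega) rfl (shade_two_mul δ 1)
        (O.rot (n := 1) h' x) (O.rot (n := 0) h' y))) =
    O.rot (n := 0) h' (O.cap (n := 1) 2 (by omega) (O.cap (n := 2) 3 (by omega)
      (O.ins (m := 2) (n := 1) (k := 3) 4 (by omega) rfl (shade_two_mul ε 2) x y))) := by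
  calc _ = O.cap (n := 1) 1 (by omega) (O.cap (n := 2) 2 (by omega)
      (O.ins (m := 2) (n := 1) (k := 3) 3 (by omega) rfl (shade_eq_of_bodd_eq_true h' rfl)
        (O.cap (n := 2) 3 (by omega) (O.ins (m := 2) (n := 1) (k := 3) 2 (by omega) rfl
            (shade_two_mul δ 1) (O.rot (n := 1) h' x) 1)) y)) := by
        rw [O.rot_apply h' y]
        generalize O.rot (n := 1) h' x = z
        simp
    _ = _ := by
        rw [O.zigzag_left 2]
        simp [rot_apply]

/-- Two 2-boxes side by side, with the bottom right point of `l` joined with the bottom left point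
of `k`. -/
def halfConv (l k : P 2 ε) : P 3 ε :=
  O.cap (n := 3) 1 (by omega)
    (O.ins (m := 2) (n := 2) (k := 4) 2 (by omega) rfl (shade_two_mul ε 1) l k)

/-- Two 2-boxes side by side, with the top right point of `l` joined with the top left point
of `k`. -/
def halfConv' (l k : P 2 ε) : P 3 ε :=
  O.cap (n := 3) 5 (by omega)
    (O.ins (m := 2) (n := 2) (k := 4) 2 (by omega) rfl (shade_two_mul ε 1) l k)

theorem star_halfConv (l k : P 2 ε) : star (O.halfConv l k) = O.halfConv' (star l) (star k) := by
  rw [halfConv, O.star_cap 1 5 rfl _ (by omega), O.star_ins 2 2 rfl _ (by omega)]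
  rfl

/-- The diagram is cut along the horizontal line that separates `l`, `k` from `m`, `n`. Three
strings cross it, so both halves involve 3-boxes. -/
theorem conv_mul_mul (l k m n : P 2 ε) : O.conv (l * m) (k * n) =
     O.cap (n := 2) 2 (by omega) (O.cap (n := 3) 3 (by omega) (O.cap (n := 4) 4 (by omega)
      (O.cap (n := 5) 5 (by omega)
      (O.ins (m := 3) (n := 3) (k := 6) 6 (by omega) rfl (shade_two_mul ε 3) (O.halfConv l k)
        (O.halfConv' m n))))) := by
  have h2 : shade ε 2 = ε := shade_two_mul ε 1
  have h4 : shade ε 4 = ε := shade_two_mul ε 2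
  have h6 : shade ε 6 = ε := shade_two_mul ε 3
  have h10 : shade ε 10 = ε := shade_two_mul ε 5
  calc _ = O.cap (n := 2) 1 (by omega) (O.cap (n := 3) 5 (by omega) (O.cap (n := 4) 4 (by omega)
      (O.cap (n := 5) 5 (by omega) (O.ins (m := 4) (n := 2) (k := 6) 6 (by omega) rfl h6
        (O.cap (n := 4) 6 (by omega) (O.cap (n := 5) 7 (by omega)
        (O.ins (m := 4) (n := 2) (k := 6) 2 (by omega) rfl h2
          (O.ins (m := 2) (n := 2) (k := 4) 4 (by omega) rfl h4 l m) k))) n)))) := by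
        simp [conv, O.two_box_mul]
    _ = O.cap (n := 2) 1 (by omega) (O.cap (n := 3) 5 (by omega) (O.cap (n := 4) 4 (by omega)
      (O.cap (n := 5) 5 (by omega) (O.cap (n := 6) 6 (by omega) (O.cap (n := 7) 7 (by omega)
        (O.ins (m := 6) (n := 2) (k := 8) 10 (by omega) rfl h10
        (O.ins (m := 4) (n := 2) (k := 6) 2 (by omega) rfl h2
          (O.ins (m := 2) (n := 2) (k := 4) 4 (by omega) rfl h4 l m) k) n)))))) := by
        congr 4
        rw [O.cap_ins_before 8 7, O.cap_ins_before 6 6]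
        all_goals first | omega | exact shade_two_mul ε 4
    _ = _ := by
        simp [halfConv, halfConv']
        rw [O.ins_ins_swap (j := 8) (i := 2) _ _ _ _ _ _ (by omega)]

theorem closure_mul_conv_mul (c d l k m n : P 2 ε) :
     O.closure 2 (c * O.conv (l * m) (k * n) * d) =
      O.closure 3 ((O.cap (n := 3) 2 (by omega) (O.cap (n := 4) 3 (by omega)
        (O.ins (m := 2) (n := 3) (k := 5) 4 (by omega) rfl (shade_two_mul ε 2) c
          (O.halfConv l k)))) *
        (O.cap (n := 3) 4 (by omega) (O.cap (n := 4) 5 (by omega)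
        (O.ins (m := 3) (n := 2) (k := 5) 6 (by omega) rfl (shade_two_mul ε 3)
          (O.halfConv' m n) d)))) := by
  rw [conv_mul_mul]
  generalize O.halfConv l k = u
  generalize O.halfConv' m n = v
  simp [O.two_box_mul, O.three_box_mul, PlanarOperations.closure]

/-- The rotated 2-box is an arc at the bottom and an arc carrying `a` at the top. A 2-box composed
above it meets only `a`, through `act`; this is what computes convolutions with `1 ⊗ a`. -/
theorem rot_juxtaposition (h : shade δ 1 = ε) (a : P 1 ε) :
    O.rot h (O.ins (m := 1) (n := 1) (k := 2) 2 (by omega) rfl (shade_two_mul ε 1) 1 a) =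
      O.juxt h 1 a := by
  calc _ = O.ins (m := 1) (n := 1) (k := 2) 1 (by omega) rfl h
          (O.cap (n := 1) 0 (by omega) (O.ins (m := 1) (n := 1) (k := 2) 1 (by omega) rfl h 1 1))
            a := by
        simp [rot_apply]
    _ = _ := by rw [O.zigzag_right 0]; rfl

theorem juxtaposition_mul (a : P 1 ε) (x : P 2 ε) :
    (O.ins (m := 1) (n := 1) (k := 2) 2 (by omega) rfl (shade_two_mul ε 1) 1 a) * x =
     (O.ins (m := 1) (n := 1) (k := 2) 2 (by omega) rfl (shade_two_mul ε 1) 1 (O.act x a)) := by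
  simp [O.two_box_mul, act]

theorem closure_act_mul (x : P 2 ε) (y h : P 1 ε) :
    O.closure 1 (O.act x y * h) = O.closure 1 (y * O.cap (n := 1) 2 (by omega)
        (O.cap (n := 2) 3 (by omega)
      (O.ins (m := 2) (n := 1) (k := 3) 4 (by omega) rfl (shade_two_mul ε 2) x h))) := by
  simp [O.one_box_mul, act, PlanarOperations.closure]

/-- The box `b` slides around the closing string, turning by 180 degrees twice. Closing on the right
suffices, so no sphericality is involved. -/
theorem closure_mul_comm (a b : P 1 ε) : O.closure 1 (a * b) = O.closure 1 (b * a) := by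
  rw [← O.rot_rot (shade_one_symm rfl) rfl b]
  nth_rw 1 [← rotInv_eq_rot]
  rw [← cap_ins_eq_mul_rotInv, ← cap_ins_eq_rot_mul]
  simp [PlanarOperations.closure]

end PlanarStarAlgebra

/-! ### Positive elements and their supports in a `C*`-algebra -/

section CStarLemmas

variable {A : Type u} [CStarAlgebra A]

theorem isPos_zero : IsPos (0 : A) := ⟨0, by simp⟩

theorem mul_star_self_eq_zero {a : A} (h : a * star a = 0) : a = 0 :=
  (CStarRing.mul_star_self_eq_zero_iff a).1 h

section Order

variable [PartialOrder A] [StarOrderedRing A]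

theorem isPos_iff {a : A} : IsPos a ↔ 0 ≤ a := by
  rw [CStarAlgebra.nonneg_iff_eq_mul_star_self]
  rfl

/-- If `0 ≤ b ≤ c • a` then the support of `b` is contained in the support of `a`. -/
theorem mul_eq_self_of_le_smul {a b p : A} {c : ℝ} (hp : IsStarProjection p) (hb : 0 ≤ b)
    (hba : b ≤ c • a) (hpa : p * a = a) : p * b = b ∧ b * p = b := by
  obtain ⟨s, rfl⟩ := isPos_iff.2 hb
  have h1 : star (1 - p) = 1 - p := by simp [hp.isSelfAdjoint.star_eq]
  have h2 : (1 - p) * (s * star s) * (1 - p) ≤ 0 := by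
    have := star_left_conjugate_le_conjugate hba (1 - p)
    rw [h1] at this
    refine this.trans_eq ?_
    rw [mul_smul_comm, smul_mul_assoc]
    simp [sub_mul, hpa]
  have h3 : ((1 - p) * s) * star ((1 - p) * s) = 0 := by
    refine le_antisymm ?_ (mul_star_self_nonneg _)
    rw [star_mul, h1]
    simpa [mul_assoc] using h2
  have h4 : p * s = s := by
    have := mul_star_self_eq_zero h3
    rw [sub_mul, one_mul, sub_eq_zero] at this
    exact this.symm
  refine ⟨by rw [← mul_assoc, h4], ?_⟩
  have h5 : star s * p = star s := by
    simpa [hp.isSelfAdjoint.star_eq] using congrArg star h4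
  rw [mul_assoc, h5]

/-- A selfadjoint element is nonnegative if a faithful positive functional is nonnegative on all its
conjugates. -/
theorem nonneg_of_forall_conjugate (t : A →ₗ[ℂ] ℂ)
    (ht : ∀ x, 0 ≤ (t (x * star x)).re ∧ (t (x * star x)).im = 0)
    (htf : ∀ x, t (x * star x) = 0 → x = 0) {h : A} (hh : IsSelfAdjoint h)
    (hc : ∀ c : A, 0 ≤ (t (c * h * star c)).re) : 0 ≤ h := by
  rw [← CFC.negPart_eq_zero_iff h]
  have hn : 0 ≤ h⁻ := CFC.negPart_nonneg h
  have hns : star h⁻ = h⁻ := hn.isSelfAdjoint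
  obtain ⟨s, hs⟩ := isPos_iff.2 hn
  -- Testing with `c = h⁻` gives minus the cube of `h⁻`, written as a negative square so that
  -- faithfulness applies.
  have h1 : h⁻ * h * star h⁻ = -((h⁻ * s) * star (h⁻ * s)) := by
    have : h⁻ * h = - (h⁻ * h⁻) := by
      nth_rw 2 [← CFC.posPart_sub_negPart h]
      rw [mul_sub, CFC.negPart_mul_posPart, zero_sub]
    rw [this, star_mul, hns, mul_assoc h⁻ s, ← mul_assoc s, ← hs]
    simp [mul_assoc]
  have h2 := hc h⁻
  rw [h1, map_neg, Complex.neg_re] at h2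
  have h3 := ht (h⁻ * s)
  have h4 : h⁻ * s = 0 := htf _ (Complex.ext (le_antisymm (by simpa using h2) h3.1) h3.2)
  have h5 : h⁻ * star h⁻ = 0 := by
    rw [hns]; nth_rw 2 [hs]; rw [← mul_assoc, h4, zero_mul]
  exact mul_star_self_eq_zero h5

end Order

theorem IsRangeProjection.eq {a p q : A} (hp : IsRangeProjection a p) (hq : IsRangeProjection a q) :
    p = q := by
  have h1 := hp.2.2 q hq.1 hq.2.1
  have h2 := hq.2.2 p hp.1 hp.2.1
  have h3 := congrArg star h1
  rw [star_mul, hp.1.isSelfAdjoint.star_eq, hq.1.isSelfAdjoint.star_eq] at h3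
  exact h3.symm.trans h2

/-- `p` is the support projection of the nonnegative element `a`, `g` is its square root, and `k` is
the inverse of `g` on `p`. -/
structure IsPolarData (a p g k : A) : Prop where
  proj : IsStarProjection p
  star_sqrt : star g = g
  star_inv : star k = k
  sqrt_mul_sqrt : g * g = a
  sqrt_mul_inv : g * k = p
  inv_mul_sqrt : k * g = p
  sqrt_mul_proj : g * p = g
  inv_mul_proj : k * p = k

namespace IsPolarData

variable {a p g k : A} (h : IsPolarData a p g k)
include h

theorem proj_mul_proj : p * p = p := h.proj.isIdempotentElem

theorem star_proj : star p = p := h.proj.isSelfAdjoint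

theorem proj_mul_inv : p * k = k := by
  have := congrArg star h.inv_mul_proj
  rwa [star_mul, h.star_inv, h.star_proj] at this

theorem proj_mul_sqrt : p * g = g := by
  have := congrArg star h.sqrt_mul_proj
  rwa [star_mul, h.star_sqrt, h.star_proj] at this

theorem proj_mul : p * a = a := by rw [← h.sqrt_mul_sqrt, ← mul_assoc, h.proj_mul_sqrt]

theorem mul_proj : a * p = a := by rw [← h.sqrt_mul_sqrt, mul_assoc, h.sqrt_mul_proj]

theorem mul_inv_mul_inv : a * (k * k) = p := by
  rw [← h.sqrt_mul_sqrt, mul_assoc, ← mul_assoc g k k, h.sqrt_mul_inv, h.proj_mul_inv,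
    h.sqrt_mul_inv]

theorem isRangeProjection : IsRangeProjection a p := by
  refine ⟨h.proj, h.proj_mul, fun f _ hf => ?_⟩
  rw [← h.mul_inv_mul_inv, ← mul_assoc, hf]

/-- Here `p = g k² g` and `k² ≤ ‖k²‖`: in finite rank the support is dominated by a multiple of the
element. -/
theorem proj_le [PartialOrder A] [StarOrderedRing A] : p ≤ ‖k * k‖ • a := by
  have h1 : IsSelfAdjoint (k * k) := by simp [IsSelfAdjoint, h.star_inv]
  have h2 := CStarAlgebra.star_left_conjugate_le_norm_smul (a := g) h1
  rwa [h.star_sqrt, h.sqrt_mul_sqrt, ← mul_assoc, h.sqrt_mul_inv, h.proj_mul_inv,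
    h.inv_mul_sqrt] at h2

theorem isPos : IsPos a := ⟨g, by rw [h.star_sqrt, h.sqrt_mul_sqrt]⟩

end IsPolarData

/-! ### Functional calculus and spectra in finite dimension -/

section FiniteDimensional

variable [FiniteDimensional ℂ A]

theorem finite_real_spectrum (a : A) : (spectrum ℝ a).Finite := by
  have : FiniteDimensional ℝ A := FiniteDimensional.trans ℝ ℂ A
  have hq := minpoly.ne_zero (Algebra.IsIntegral.isIntegral (R := ℝ) a)
  refine ((minpoly ℝ a).rootSet_finite ℝ).subset fun μ hμ => ?_
  rw [Polynomial.mem_rootSet]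
  refine ⟨hq, ?_⟩
  have h := spectrum.subset_polynomial_aeval a (minpoly ℝ a) ⟨μ, hμ, rfl⟩
  rw [minpoly.aeval, spectrum.mem_iff, sub_zero] at h
  by_contra h0
  exact h ((IsUnit.mk0 _ (by simpa using h0)).map _)

theorem exists_isPolarData {a : A} (ha : IsPos a) : ∃ p g k : A, IsPolarData a p g k := by
  let := CStarAlgebra.spectralOrder A
  have := CStarAlgebra.spectralOrderedRing A
  rw [isPos_iff] at ha
  -- Every function is continuous on a finite set, so the discontinuous functions `1_{t ≠ 0}` and
  -- `t^{-1/2}` are admissible.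
  have hc (f : ℝ → ℝ) : ContinuousOn f (spectrum ℝ a) := (finite_real_spectrum a).continuousOn f
  have hs : ∀ t ∈ spectrum ℝ a, 0 ≤ t := fun t ht => spectrum_nonneg_of_nonneg ha ht
  have hmul (f f' f'' : ℝ → ℝ) (hf : ∀ t, 0 ≤ t → f t * f' t = f'' t) :
      cfc f a * cfc f' a = cfc f'' a := by
    rw [← cfc_mul f f' a (hc f) (hc f')]
    exact cfc_congr fun t ht => hf t (hs t ht)
  have hsa (f : ℝ → ℝ) : star (cfc f a) = cfc f a := cfc_predicate f a
  refine ⟨cfc (fun t => if t = 0 then 0 else 1) a, cfc Real.sqrt a,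
    cfc (fun t => (Real.sqrt t)⁻¹) a,
    ⟨hmul _ _ _ fun t _ => by split <;> simp, hsa _⟩, hsa _, hsa _, ?_, ?_, ?_, ?_, ?_⟩
  · exact (hmul _ _ id fun t ht => Real.mul_self_sqrt ht).trans (cfc_id ℝ a)
  · refine hmul _ _ _ fun t ht => ?_
    split_ifs with h0
    · simp [h0]
    · exact mul_inv_cancel₀ (Real.sqrt_ne_zero'.2 (lt_of_le_of_ne ht (Ne.symm h0)))
  · refine hmul _ _ _ fun t ht => ?_
    split_ifs with h0
    · simp [h0]
    · exact inv_mul_cancel₀ (Real.sqrt_ne_zero'.2 (lt_of_le_of_ne ht (Ne.symm h0)))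
  · refine hmul _ _ _ fun t ht => ?_
    split_ifs with h0 <;> simp [h0]
  · refine hmul _ _ _ fun t ht => ?_
    split_ifs with h0 <;> simp [h0]

/-- The square root is a polynomial. -/
theorem exists_polynomial_sqrt {a : A} (ha : IsPos a) :
    ∃ f : Polynomial ℝ, star (Polynomial.aeval a f) = Polynomial.aeval a f ∧
      Polynomial.aeval a f * Polynomial.aeval a f = a := by
  let := CStarAlgebra.spectralOrder A
  have := CStarAlgebra.spectralOrderedRing A
  rw [isPos_iff] at ha
  have hs : ∀ t ∈ spectrum ℝ a, 0 ≤ t := fun t ht => spectrum_nonneg_of_nonneg ha ht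
  set S := (finite_real_spectrum a).toFinset
  refine ⟨Lagrange.interpolate S id Real.sqrt, ?_, ?_⟩
  · rw [← cfc_polynomial (R := ℝ) (Lagrange.interpolate S id Real.sqrt) a]
    exact (IsSelfAdjoint.cfc : IsSelfAdjoint (cfc (R := ℝ) _ a))
  · rw [← map_mul, ← cfc_polynomial (R := ℝ) _ a]
    conv_rhs => rw [← cfc_id ℝ a]
    refine cfc_congr fun t ht => ?_
    have h1 : (Lagrange.interpolate S id Real.sqrt).eval t = Real.sqrt t :=
      Lagrange.eval_interpolate_at_node (v := id) (i := t) Real.sqrt (Function.injective_id.injOn)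
        (by simpa [S] using ht)
    simp only [Polynomial.eval_mul, h1]
    exact Real.mul_self_sqrt (hs t ht)

/-- Each root `μ` of the minimal polynomial is in the spectrum: were `a - μ` invertible, the
cofactor would annihilate `a` and have smaller degree. So all roots vanish and the minimal
polynomial is a power of `X`. -/
theorem isNilpotent_of_spectralRadius_eq_zero {a : A} (ha : spectralRadius ℂ a = 0) :
    IsNilpotent a := by
  have hint : IsIntegral ℂ a := Algebra.IsIntegral.isIntegral a
  have hq := minpoly.ne_zero hint
  have hroot : ∀ μ ∈ (minpoly ℂ a).roots, μ = 0 := by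
    intro μ hμ
    rw [Polynomial.mem_roots hq] at hμ
    have hspec : μ ∈ spectrum ℂ a := by
      rw [spectrum.mem_iff]
      intro hu
      obtain ⟨s, hs⟩ := Polynomial.dvd_iff_isRoot.2 hμ
      have h0 := minpoly.aeval ℂ a
      rw [hs, map_mul, map_sub, Polynomial.aeval_X, Polynomial.aeval_C] at h0
      have hu' : IsUnit (a - algebraMap ℂ A μ) := by simpa using hu.neg
      have h1 := hu'.mul_right_eq_zero.1 h0
      have hs0 : s ≠ 0 := by rintro rfl; simp [hs] at hq
      have h2 := minpoly.degree_le_of_ne_zero ℂ a hs0 h1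
      rw [hs, Polynomial.degree_mul, Polynomial.degree_X_sub_C] at h2
      rw [Polynomial.degree_eq_natDegree hs0] at h2
      norm_cast at h2
      omega
    have h1 : (‖μ‖₊ : ENNReal) ≤ spectralRadius ℂ a := le_iSup₂ (α := ENNReal) μ hspec
    simpa [ha] using h1
  have h1 := (IsAlgClosed.splits (minpoly ℂ a)).eq_prod_roots
  rw [Multiset.eq_replicate_card.2 hroot, (minpoly.monic hint).leadingCoeff] at h1
  have h2 := minpoly.aeval ℂ a
  rw [h1] at h2
  simp at h2
  exact ⟨_, h2⟩

end FiniteDimensional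

/-! ### Abel means of power-bounded elements -/

section AbelMean

/-- The sum is the resolvent of `a` at `z`; multiplying the series by `a` shifts it by one term. -/
theorem mul_eq_of_hasSum {A : Type u} [NormedRing A] [NormedAlgebra ℂ A]
    {a S : A} {z : ℂ} (hz : z ≠ 0)
    (hS : HasSum (fun j : ℕ => (z ^ (j + 1))⁻¹ • a ^ j) S) :
    a * S = z • S - 1 ∧ S * a = z • S - 1 := by
  have h1 := ((hasSum_nat_add_iff' 1).2 hS).const_smul z
  have h2 : ∀ j : ℕ, z • (z ^ (j + 1 + 1))⁻¹ • a ^ (j + 1) = (z ^ (j + 1))⁻¹ • a ^ (j + 1) := by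
    intro j
    rw [smul_smul]
    congr 1
    field_simp
    ring
  simp only [h2] at h1
  simp only [Finset.range_one, Finset.sum_singleton, pow_zero, zero_add, pow_one, smul_sub,
    smul_smul, mul_inv_cancel₀ hz, one_smul] at h1
  constructor
  · refine (hS.mul_left a).unique ?_
    simpa only [mul_smul_comm, ← pow_succ'] using h1
  · refine (hS.mul_right a).unique ?_
    simpa only [smul_mul_assoc, ← pow_succ] using h1

/-- Power-boundedness gives `‖(z - r) S(z)‖ ≤ C`. With `b = r - a`, this makes `(z - r) u b S(z)`
tend to `0` for every `u`, while `(z - r) v S(z) = v` whenever `v b = 0`. So the kernel and the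
range of right multiplication by `b` meet in `0`, and by dimension they span. Splitting `1 = k + u
b` shows that the limit is `k`. -/
theorem exists_tendsto_abel_mean {A : Type u} [NormedRing A] [NormedAlgebra ℂ A]
    [FiniteDimensional ℂ A] {a : A} {r C : ℝ} (hr : 0 < r) (hC : ∀ j, ‖a ^ j‖ ≤ C * r ^ j) :
    ∃ (S : ℝ → A) (y : A),
      (∀ z : ℝ, r < z → HasSum (fun j : ℕ => ((z : ℂ) ^ (j + 1))⁻¹ • a ^ j) (S z)) ∧
      Tendsto (fun z : ℝ => ((z - r : ℝ) : ℂ) • S z) (𝓝[>] r) (𝓝 y) := by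
  have : CompleteSpace A := FiniteDimensional.complete ℂ A
  have hbound : ∀ z : ℝ, r < z → ∀ j : ℕ,
      ‖((z : ℂ) ^ (j + 1))⁻¹ • a ^ j‖ ≤ C / z * (r / z) ^ j := by
    intro z hz j
    have hz0 : 0 < z := hr.trans hz
    rw [norm_smul, norm_inv, norm_pow, Complex.norm_real, Real.norm_of_nonneg hz0.le]
    calc _ ≤ (z ^ (j + 1))⁻¹ * (C * r ^ j) := by gcongr; exact hC j
      _ = _ := by rw [div_pow]; field_simp; ring
  have hgeom : ∀ z : ℝ, r < z → HasSum (fun j : ℕ => C / z * (r / z) ^ j) (C / (z - r)) := by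
    intro z hz
    have hz0 : 0 < z := hr.trans hz
    have h1 := (hasSum_geometric_of_lt_one (r := r / z) (by positivity)
      ((div_lt_one hz0).2 hz)).mul_left (C / z)
    have h2 : z - r ≠ 0 := (sub_pos.2 hz).ne'
    have h3 : C / (z - r) = C / z * (1 - r / z)⁻¹ := by
      rw [one_sub_div hz0.ne']
      field_simp
    rwa [h3]
  have hsum : ∀ z : ℝ, r < z → Summable (fun j : ℕ => ((z : ℂ) ^ (j + 1))⁻¹ • a ^ j) :=
    fun z hz => Summable.of_norm_bounded (hgeom z hz).summable (hbound z hz)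
  set S : ℝ → A := fun z => ∑' j : ℕ, ((z : ℂ) ^ (j + 1))⁻¹ • a ^ j with hSdef
  have hS : ∀ z : ℝ, r < z → HasSum (fun j : ℕ => ((z : ℂ) ^ (j + 1))⁻¹ • a ^ j) (S z) :=
    fun z hz => (hsum z hz).hasSum
  have hSnorm : ∀ z : ℝ, r < z → ‖((z - r : ℝ) : ℂ) • S z‖ ≤ C := by
    intro z hz
    have h1 : ‖S z‖ ≤ C / (z - r) := tsum_of_norm_bounded (hgeom z hz) (hbound z hz)
    rw [norm_smul, Complex.norm_real, Real.norm_of_nonneg (sub_pos.2 hz).le]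
    calc _ ≤ (z - r) * (C / (z - r)) := mul_le_mul_of_nonneg_left h1 (sub_pos.2 hz).le
      _ = C := mul_div_cancel₀ _ (sub_pos.2 hz).ne'
  have hmul : ∀ z : ℝ, r < z → a * S z = (z : ℂ) • S z - 1 := fun z hz =>
    (mul_eq_of_hasSum (by exact_mod_cast (hr.trans hz).ne') (hS z hz)).1
  set b : A := (r : ℂ) • 1 - a with hb
  have hbS : ∀ z : ℝ, r < z → b * S z = 1 - ((z - r : ℝ) : ℂ) • S z := by
    intro z hz
    rw [hb, sub_mul, smul_mul_assoc, one_mul, hmul z hz, Complex.ofReal_sub, sub_smul]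
    abel
  have htend : Tendsto (fun z : ℝ => ((z - r : ℝ) : ℂ)) (𝓝[>] r) (𝓝 0) := by
    have : Tendsto (fun z : ℝ => ((z - r : ℝ) : ℂ)) (𝓝 r) (𝓝 ((r - r : ℝ) : ℂ)) :=
      (Complex.continuous_ofReal.comp (continuous_id.sub continuous_const)).tendsto r
    rw [sub_self, Complex.ofReal_zero] at this
    exact this.mono_left nhdsWithin_le_nhds
  have hrange : ∀ u : A,
      Tendsto (fun z : ℝ => ((z - r : ℝ) : ℂ) • (u * b * S z)) (𝓝[>] r) (𝓝 0) := by
    intro u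
    have h1 : Tendsto (fun z : ℝ => ((z - r : ℝ) : ℂ) • (u * (1 - ((z - r : ℝ) : ℂ) • S z)))
        (𝓝[>] r) (𝓝 0) := by
      refine htend.zero_smul_isBoundedUnder_le ?_
      refine ⟨‖u‖ * (‖(1 : A)‖ + C), ?_⟩
      rw [eventually_map]
      filter_upwards [self_mem_nhdsWithin] with z hz
      refine (norm_mul_le _ _).trans ?_
      gcongr
      exact (norm_sub_le _ _).trans (by gcongr; exact hSnorm z hz)
    refine h1.congr' ?_
    filter_upwards [self_mem_nhdsWithin] with z hz
    rw [mul_assoc, hbS z hz]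
  have hker : ∀ v : A, v * b = 0 → ∀ z : ℝ, r < z → ((z - r : ℝ) : ℂ) • (v * S z) = v := by
    intro v hv z hz
    have h1 : v * (b * S z) = 0 := by rw [← mul_assoc, hv, zero_mul]
    rw [hbS z hz, mul_sub, mul_one, mul_smul_comm, sub_eq_zero] at h1
    exact h1.symm
  set f : A →ₗ[ℂ] A := LinearMap.mulRight ℂ b
  have hdisj : Disjoint (LinearMap.ker f) (LinearMap.range f) := by
    rw [Submodule.disjoint_def]
    rintro _ hv ⟨u, rfl⟩
    have hv' : u * b * b = 0 := hv
    refine tendsto_nhds_unique (f := fun _ : ℝ => u * b) (l := 𝓝[>] r) tendsto_const_nhds ?_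
    refine (hrange u).congr' ?_
    filter_upwards [self_mem_nhdsWithin] with z hz
    exact hker _ hv' z hz
  have htop := Submodule.eq_top_of_disjoint _ _
    ((add_comm _ _).trans (LinearMap.finrank_range_add_finrank_ker f)).ge hdisj
  obtain ⟨k, hk, _, ⟨u, rfl⟩, hku⟩ := Submodule.mem_sup.1 (htop ▸ Submodule.mem_top (x := (1 : A)))
  refine ⟨S, k, hS, ?_⟩
  have h1 := (tendsto_const_nhds (x := k) (f := 𝓝[>] r)).add (hrange u)
  rw [add_zero] at h1
  refine h1.congr' ?_
  filter_upwards [self_mem_nhdsWithin] with z hz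
  have hk' : k * b = 0 := hk
  have hku' : k + u * b = 1 := hku
  conv_rhs => rw [← one_mul (S z), ← hku', add_mul, smul_add, hker k hk' z hz]

end AbelMean

end CStarLemmas

/-! ### The two legs of a rotated 2-box and the closure of its left string -/

namespace PlanarStarAlgebra

variable {P : ℕ → Bool → Type u} [∀ n ε, Ring (P n ε)] [∀ n ε, Algebra ℂ (P n ε)]
  [∀ n ε, StarRing (P n ε)] [∀ n ε, StarModule ℂ (P n ε)] (O : PlanarStarAlgebra P)
  {ε δ γ : Bool}

/-- The 1-box `a` on the right string of a 2-box. -/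
def rightLeg (h : shade δ 1 = ε) : P 1 ε →ₗ[ℂ] P 2 δ :=
  O.ins (m := 1) (n := 1) (k := 2) 1 (by omega) rfl h 1

/-- The 1-box `a`, rotated by 180 degrees, on the left string of a 2-box. -/
def leftLeg (h : shade δ 1 = ε) : P 1 ε →ₗ[ℂ] P 2 δ :=
  ((O.ins (m := 1) (n := 1) (k := 2) 1 (by omega) rfl h).flip 1).comp (O.rot (n := 0) h)

theorem rightLeg_apply (h : shade δ 1 = ε) (a : P 1 ε) : O.rightLeg h a = O.juxt h 1 a := rfl

theorem leftLeg_apply (h : shade δ 1 = ε) (a : P 1 ε) :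
    O.leftLeg h a = O.juxt h (O.rot (n := 0) h a) 1 := rfl

variable (h : shade δ 1 = ε)

theorem rightLeg_mul (a b : P 1 ε) : O.rightLeg h (a * b) = O.rightLeg h a * O.rightLeg h b := by
  simp only [rightLeg_apply, juxt_mul_juxt, one_mul]

theorem leftLeg_mul (a b : P 1 ε) : O.leftLeg h (a * b) = O.leftLeg h b * O.leftLeg h a := by
  simp only [leftLeg_apply, juxt_mul_juxt, one_mul, rot_mul]

theorem leftLeg_mul_rightLeg (a b : P 1 ε) :
    O.leftLeg h a * O.rightLeg h b = O.rightLeg h b * O.leftLeg h a := by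
  simp only [rightLeg_apply, leftLeg_apply, juxt_mul_juxt, one_mul, mul_one]

theorem star_rightLeg (a : P 1 ε) : star (O.rightLeg h a) = O.rightLeg h (star a) := by
  simp only [rightLeg_apply, star_juxt, star_one]

theorem star_leftLeg (a : P 1 ε) : star (O.leftLeg h a) = O.leftLeg h (star a) := by
  simp only [leftLeg_apply, star_juxt, star_one, star_rot_one_box]

theorem rot_juxt_rot_right_mul (h' : shade ε 1 = δ) (a : P 1 ε) (x : P 2 ε) :
    O.rot h (O.juxt h' 1 (O.rot (n := 0) h a) * x) = O.leftLeg h a * O.rot h x :=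
  O.rot_juxt_one_left_mul h h' _ x

theorem rot_mul_juxt_rot_right (h' : shade ε 1 = δ) (a : P 1 ε) (x : P 2 ε) :
    O.rot h (x * O.juxt h' 1 (O.rot (n := 0) h a)) = O.rightLeg h a * O.rot h x := by
  rw [rot_mul_juxt_one_left, rot_rot]
  rfl

theorem rot_juxt_left_mul (h' : shade ε 1 = δ) (a : P 1 ε) (x : P 2 ε) :
    O.rot h (O.juxt h' a 1 * x) = O.rot h x * O.leftLeg h a :=
  O.rot_juxt_one_right_mul h h' a x

theorem rot_mul_juxt_left (h' : shade ε 1 = δ) (a : P 1 ε) (x : P 2 ε) :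
    O.rot h (x * O.juxt h' a 1) = O.rot h x * O.rightLeg h a :=
  O.rot_mul_juxt_one_right h h' a x

theorem juxt_eq (h' : shade ε 1 = δ) (a : P 1 ε) (b : P 1 δ) :
    O.juxt h' a b = O.juxt h' a 1 * O.juxt h' 1 b := by
  rw [juxt_mul_juxt, one_mul, mul_one]

theorem rot_cutDown (h' : shade ε 1 = δ) (p : P 1 ε) (x : P 2 ε) :
    O.rot h (O.juxt h' p (O.rot (n := 0) h p) * x * O.juxt h' p (O.rot (n := 0) h p)) =
      O.leftLeg h p * O.rightLeg h p * O.rot h x * (O.leftLeg h p * O.rightLeg h p) := by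
  have h1 : O.juxt h' p (O.rot (n := 0) h p) * x * O.juxt h' p (O.rot (n := 0) h p) =
      (O.juxt h' p 1 * (O.juxt h' 1 (O.rot (n := 0) h p) * x)) *
        O.juxt h' p 1 * O.juxt h' 1 (O.rot (n := 0) h p) := by
    rw [juxt_eq]
    simp only [mul_assoc]
  rw [h1, rot_mul_juxt_rot_right, rot_mul_juxt_left, rot_juxt_left_mul, rot_juxt_rot_right_mul,
    leftLeg_mul_rightLeg]
  simp only [mul_assoc]
  rw [leftLeg_mul_rightLeg]

theorem act_one_left (y : P 1 ε) : O.act 1 y = y := by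
  rw [← O.juxt_one_one (δ := shade ε 1) rfl, act_juxt, rot_one, one_mul, mul_one]

theorem closeLeft_rot (h' : shade ε 1 = δ) (x : P 2 ε) :
    O.closeLeft h' (O.rot h x) = O.act x 1 := by
  rw [closeLeft_apply, rotInv_rot, act]
  congr 1
  exact (O.zigzag_ins_one_left _ _ _ _ x).symm

theorem closeLeft_leftLeg_mul (h' : shade ε 1 = δ) (y : P 1 ε) (x : P 2 ε) :
    O.closeLeft h' (O.leftLeg h y * O.rot h x) = O.act x y := by
  rw [← O.rot_juxt_rot_right_mul h h', closeLeft_rot, act_mul, act_juxt, rot_rot, one_mul, mul_one]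

theorem closeLeft_mul_leftLeg (h' : shade ε 1 = δ) (y : P 1 ε) (x : P 2 ε) :
    O.closeLeft h' (O.rot h x * O.leftLeg h y) = O.act x y := by
  rw [← O.rot_juxt_left_mul h h', closeLeft_rot, act_mul, act_juxt, rot_one, one_mul, one_mul]

theorem closeLeft_rightLeg_mul (h' : shade ε 1 = δ) (a : P 1 ε) (w : P 2 δ) :
    O.closeLeft h' (O.rightLeg h a * w) = a * O.closeLeft h' w := by
  rw [← O.rot_rotInv h' h w, ← O.rot_mul_juxt_rot_right h h', closeLeft_rot, closeLeft_rot, act_mul,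
    act_juxt, rot_rot, mul_one]

theorem closeLeft_mul_rightLeg (h' : shade ε 1 = δ) (a : P 1 ε) (w : P 2 δ) :
    O.closeLeft h' (w * O.rightLeg h a) = O.closeLeft h' w * a := by
  rw [← O.rot_rotInv h' h w, ← O.rot_mul_juxt_left h h', closeLeft_rot, closeLeft_rot, act_mul,
    act_juxt, rot_one, one_mul]

theorem closeLeft_leftLeg_comm (h' : shade ε 1 = δ) (a : P 1 ε) (w : P 2 δ) :
    O.closeLeft h' (O.leftLeg h a * w) = O.closeLeft h' (w * O.leftLeg h a) := by
  rw [← O.rot_rotInv h' h w, closeLeft_leftLeg_mul, closeLeft_mul_leftLeg]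

theorem star_closeLeft (h' : shade ε 1 = δ) (w : P 2 δ) :
    star (O.closeLeft h' w) = O.closeLeft h' (star w) := by
  rw [closeLeft_apply, O.star_cap 0 2 rfl _ (by omega), ← star_star w, star_star (star w),
    ← O.star_rot, star_star, closeLeft_apply]
  simp [rot_apply, rotInv_apply, cap_cap_of_le]

theorem conv_rightLeg (a : P 1 ε) (x : P 2 ε) :
    O.conv (O.rightLeg h a) (O.rot h x) = O.rightLeg h (O.act x a) := by
  rw [rightLeg_apply, rightLeg_apply, ← rot_juxtaposition, conv_rot_rot, juxtaposition_mul,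
    rot_juxtaposition]

theorem star_conv (z w : P 2 ε) : star (O.conv z w) = O.conv (star z) (star w) := by
  rw [conv, O.star_cap 1 3 rfl _ (by omega), O.star_cap 5 1 rfl _ (by omega),
    O.star_ins 2 2 rfl _ (by omega)]
  exact (O.cap_cap 1 3 (by omega) _ _ _ _ _).symm

end PlanarStarAlgebra

/-! ### Positivity of partial closures and convolutions -/

namespace CStarPlanarAlgebra

variable {P : ℕ → Bool → Type u} [∀ n ε, CStarAlgebra (P n ε)] (pa : CStarPlanarAlgebra P)
  {ε δ : Bool}

attribute [local instance] CStarAlgebra.spectralOrder CStarAlgebra.spectralOrderedRing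

/-- The trace of `n`-boxes. -/
noncomputable def tr (n : ℕ) (ε : Bool) : P n ε →ₗ[ℂ] ℂ := (pa.tr₀ ε).comp (pa.closure n)

theorem tr_apply (n : ℕ) (x : P n ε) : pa.tr n ε x = pa.tr₀ ε (pa.closure n x) := rfl

theorem tr_mul_star_self (n : ℕ) (x : P n ε) :
    0 ≤ (pa.tr n ε (x * star x)).re ∧ (pa.tr n ε (x * star x)).im = 0 := pa.tr_nonneg n ε x

theorem eq_zero_of_tr_mul_star_self {n : ℕ} {x : P n ε} (hx : pa.tr n ε (x * star x) = 0) :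
    x = 0 := pa.tr_faithful n ε x hx

theorem nonneg_of_tr_conjugate {n : ℕ} {x : P n ε} (hx : IsSelfAdjoint x)
    (hc : ∀ c, 0 ≤ (pa.tr n ε (c * x * star c)).re) : 0 ≤ x :=
  nonneg_of_forall_conjugate (pa.tr n ε) (pa.tr_mul_star_self n)
    (fun _ => pa.eq_zero_of_tr_mul_star_self) hx hc

theorem tr_mul_comm (a b : P 1 ε) : pa.tr 1 ε (a * b) = pa.tr 1 ε (b * a) := by
  rw [tr_apply, tr_apply, pa.closure_mul_comm]

/-- All traces close on the right. Bending the string closed on the left around the boxes rotates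
`m` and its adjoint in opposite directions, and the result is again a right trace of a square. -/
theorem tr_closeLeft_mul_star (h : shade ε 1 = δ) (m : P 2 δ) :
    pa.tr 1 ε (pa.closeLeft h (m * star m)) =
      pa.tr 2 ε (pa.rot h m * star (pa.rot h m)) := by
  rw [tr_apply, pa.closure_closeLeft_mul, tr_apply, pa.star_rot]

theorem closeLeft_nonneg (h : shade ε 1 = δ) {w : P 2 δ} (hw : 0 ≤ w) :
    0 ≤ pa.closeLeft h w := by
  obtain ⟨m, rfl⟩ := isPos_iff.2 hw
  refine pa.nonneg_of_tr_conjugate ?_ fun c => ?_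
  · rw [IsSelfAdjoint, pa.star_closeLeft h, star_mul, star_star]
  · have h' := shade_one_symm h
    rw [← pa.closeLeft_rightLeg_mul h' h, ← pa.closeLeft_mul_rightLeg h' h, ← pa.star_rightLeg,
      ← mul_assoc, mul_assoc, ← star_mul, tr_closeLeft_mul_star]
    exact (pa.tr_mul_star_self 2 _).1

theorem eq_zero_of_closeLeft_mul_star (h : shade ε 1 = δ) {m : P 2 δ}
    (hm : pa.closeLeft h (m * star m) = 0) : m = 0 := by
  have h1 := pa.tr_closeLeft_mul_star h m
  rw [hm, map_zero] at h1
  rw [← pa.rotInv_rot h (shade_one_symm h) m, pa.eq_zero_of_tr_mul_star_self h1.symm, map_zero]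

/-- A Schur product theorem: cut in the middle, the trace of `c (l l* ∗ k k*) c*` is the trace of a
3-box times its adjoint. -/
theorem conv_nonneg {z w : P 2 ε} (hz : 0 ≤ z) (hw : 0 ≤ w) : 0 ≤ pa.conv z w := by
  obtain ⟨l, rfl⟩ := isPos_iff.2 hz
  obtain ⟨k, rfl⟩ := isPos_iff.2 hw
  refine pa.nonneg_of_tr_conjugate ?_ fun c => ?_
  · rw [IsSelfAdjoint, pa.star_conv, star_mul, star_mul, star_star, star_star]
  · rw [tr_apply, pa.closure_mul_conv_mul]
    have h1 := (pa.tr_mul_star_self 3 (pa.cap (n := 3) 2 (by omega) (pa.cap (n := 4) 3 (by omega)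
        (pa.ins (m := 2) (n := 3) (k := 5) 4 (by omega) rfl (shade_two_mul ε 2) c
          (pa.halfConv l k))))).1
    rw [pa.star_cap 2 4 rfl _ (by omega), pa.star_cap 3 5 rfl _ (by omega),
      pa.star_ins 4 0 rfl _ (by omega) _ _ (shade_eq_of_bodd_eq_false rfl), pa.ins_zero _ _ _ rfl,
      pa.star_halfConv] at h1
    exact h1

end CStarPlanarAlgebra

/-! ### Domination and supports -/

section

variable {A : Type u} [CStarAlgebra A] [PartialOrder A] [StarOrderedRing A]

theorem le_norm_smul_of_corner {p y : A} (hp : IsStarProjection p) (hy : IsSelfAdjoint y)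
    (h : p * y * p = y) : y ≤ ‖y‖ • p := by
  have h1 := CStarAlgebra.star_left_conjugate_le_norm_smul (a := p) hy
  rwa [hp.isSelfAdjoint.star_eq, h, hp.isIdempotentElem] at h1

theorem IsPolarData.exists_le_smul {a p g k y : A} (h : IsPolarData a p g k) (hy : IsSelfAdjoint y)
    (hpy : p * y * p = y) : ∃ c : ℝ, 0 ≤ c ∧ y ≤ c • a := by
  refine ⟨‖y‖ * ‖k * k‖, by positivity, ?_⟩
  rw [mul_smul]
  exact (le_norm_smul_of_corner h.proj hy hpy).trans
    (smul_le_smul_of_nonneg_left h.proj_le (norm_nonneg _))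

/-- Nonnegative elements that dominate multiples of each other have the same support. -/
theorem IsPolarData.proj_eq_of_le {a b p q g k g' k' : A} (ha : IsPolarData a p g k)
    (hb : IsPolarData b q g' k') {c c' : ℝ} (h : a ≤ c • b) (h' : b ≤ c' • a) : p = q := by
  have h1 := (mul_eq_self_of_le_smul hb.proj (isPos_iff.1 ha.isPos) h hb.proj_mul).1
  have h2 := (mul_eq_self_of_le_smul ha.proj (isPos_iff.1 hb.isPos) h' ha.proj_mul).1
  exact ha.isRangeProjection.eq ⟨hb.proj, h1, fun f hf hfa => by
    have h5 : p * q = q := hb.isRangeProjection.2.2 p ha.proj h2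
    have h6 : f * p = p := ha.isRangeProjection.2.2 f hf hfa
    rw [← h5, ← mul_assoc, h6]⟩

end

namespace PlanarStarAlgebra

variable {P : ℕ → Bool → Type u} [∀ n ε, Ring (P n ε)] [∀ n ε, Algebra ℂ (P n ε)]
  [∀ n ε, StarRing (P n ε)] [∀ n ε, StarModule ℂ (P n ε)] (O : PlanarStarAlgebra P)
  {ε δ γ : Bool}

theorem act_add_right (x : P 2 ε) (y z : P 1 ε) : O.act x (y + z) = O.act x y + O.act x z := by
  simp [act]

theorem act_sub_right (x : P 2 ε) (y z : P 1 ε) : O.act x (y - z) = O.act x y - O.act x z := by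
  simp [act]

theorem act_smul_right (x : P 2 ε) (c : ℂ) (y : P 1 ε) : O.act x (c • y) = c • O.act x y := by
  simp [act]

theorem act_zero_left (y : P 1 ε) : O.act 0 y = 0 := by
  simp [act]

/-- The composition with a fixed 1-box at the bottom. -/
def actLeft (y : P 1 ε) : P 2 ε →ₗ[ℂ] P 1 ε where
  toFun x := O.act x y
  map_add' a b := by simp [act]
  map_smul' c a := by simp [act]

theorem actLeft_apply (x : P 2 ε) (y : P 1 ε) : O.actLeft y x = O.act x y := rfl

theorem conv_smul_left (c : ℂ) (z w : P 2 ε) : O.conv (c • z) w = c • O.conv z w := by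
  simp [conv]

theorem conv_sub_left (z z' w : P 2 ε) : O.conv (z - z') w = O.conv z w - O.conv z' w := by
  simp [conv]

theorem act_cutDown (h : shade δ 1 = ε) (h' : shade ε 1 = δ) (p y : P 1 ε) (x : P 2 ε) :
    O.act (O.juxt h' p (O.rot (n := 0) h p) * x * O.juxt h' p (O.rot (n := 0) h p)) y =
      p * O.act x (p * y * p) * p := by
  rw [act_mul, act_mul, act_juxt, act_juxt, rot_rot, mul_assoc, mul_assoc p y p]

theorem rot_injective {n : ℕ} (h : shade δ 1 = ε) :
    Function.Injective (O.rot (n := n) h) :=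
  Function.LeftInverse.injective (O.rotInv_rot h (shade_one_symm h))

end PlanarStarAlgebra

/-! ### Perron-Frobenius theory in the corner cut out by an eigenvector -/

namespace CStarPlanarAlgebra

variable {P : ℕ → Bool → Type u} [∀ n ε, CStarAlgebra (P n ε)] (pa : CStarPlanarAlgebra P)
  {ε δ : Bool} (h : shade δ 1 = ε) (h' : shade ε 1 = δ)

attribute [local instance] CStarAlgebra.spectralOrder CStarAlgebra.spectralOrderedRing

include h h' in
-- For `y = c c*`, moving one factor cyclically along the closed left string exhibits the value as
-- the partial closure of `L(c) x̂ L(c)*`.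
theorem act_nonneg {x : P 2 ε} (hx : 0 ≤ pa.rot h x) {y : P 1 ε} (hy : 0 ≤ y) :
    0 ≤ pa.act x y := by
  obtain ⟨c, rfl⟩ := isPos_iff.2 hy
  rw [← pa.closeLeft_mul_leftLeg h h', pa.leftLeg_mul, ← mul_assoc, ← pa.closeLeft_leftLeg_comm h,
    ← pa.star_leftLeg, ← mul_assoc]
  exact pa.closeLeft_nonneg h' (star_right_conjugate_nonneg hx _)

theorem act_real_smul (x : P 2 ε) (c : ℝ) (y : P 1 ε) : pa.act x (c • y) = c • pa.act x y := by
  rw [← Complex.coe_smul, pa.act_smul_right, Complex.coe_smul]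

include h h' in
theorem act_mono {x : P 2 ε} (hx : 0 ≤ pa.rot h x) {y z : P 1 ε} (hyz : y ≤ z) :
    pa.act x y ≤ pa.act x z := by
  rw [← sub_nonneg, ← pa.act_sub_right]
  exact pa.act_nonneg h h' hx (sub_nonneg.2 hyz)

theorem conv_mono {z z' w : P 2 ε} (hz : z ≤ z') (hw : 0 ≤ w) : pa.conv z w ≤ pa.conv z' w := by
  rw [← sub_nonneg, ← pa.conv_sub_left]
  exact pa.conv_nonneg (sub_nonneg.2 hz) hw

theorem conv_real_smul (c : ℝ) (z w : P 2 ε) : pa.conv (c • z) w = c • pa.conv z w := by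
  rw [← Complex.coe_smul, pa.conv_smul_left, Complex.coe_smul]

theorem rightLeg_mono {y z : P 1 ε} (hyz : y ≤ z) : pa.rightLeg h y ≤ pa.rightLeg h z := by
  rw [← sub_nonneg, ← map_sub]
  obtain ⟨c, hc⟩ := isPos_iff.2 (sub_nonneg.2 hyz)
  rw [hc, pa.rightLeg_mul, ← pa.star_rightLeg]
  exact mul_star_self_nonneg _

include h h' in
theorem act_pow_nonneg {x : P 2 ε} (hx : 0 ≤ pa.rot h x) (j : ℕ) {y : P 1 ε} (hy : 0 ≤ y) :
    0 ≤ pa.act (x ^ j) y := by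
  induction j with
  | zero => rwa [pow_zero, pa.act_one_left]
  | succ j ih =>
    rw [pow_succ, pa.act_mul]
    exact pa.act_nonneg h h' hx ih

include h' in
theorem leftLeg_mul_rot_eq_zero {x : P 2 ε} (hx : 0 ≤ pa.rot h x) {c : P 1 ε}
    (hc : pa.act x (c * star c) = 0) : pa.leftLeg h c * pa.rot h x = 0 := by
  obtain ⟨m, hm⟩ := isPos_iff.2 hx
  rw [← pa.closeLeft_mul_leftLeg h h', pa.leftLeg_mul, ← mul_assoc, ← pa.closeLeft_leftLeg_comm h,
    ← pa.star_leftLeg, hm, ← mul_assoc, ← mul_assoc, mul_assoc, ← star_mul] at hc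
  rw [hm, ← mul_assoc, pa.eq_zero_of_closeLeft_mul_star h' hc, zero_mul]

section CutDown

/-- The cut-down of `x` by `p ⊗ p̄`. -/
noncomputable def corner (x : P 2 ε) (p : P 1 ε) : P 2 ε :=
  pa.juxt h' p (pa.rot (n := 0) h p) * x * pa.juxt h' p (pa.rot (n := 0) h p)

theorem act_corner (x : P 2 ε) (p y : P 1 ε) :
    pa.act (pa.corner h h' x p) y = p * pa.act x (p * y * p) * p :=
  pa.act_cutDown h h' p y x

theorem rot_corner (x : P 2 ε) (p : P 1 ε) :
    pa.rot h (pa.corner h h' x p) =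
      pa.leftLeg h p * pa.rightLeg h p * pa.rot h x * (pa.leftLeg h p * pa.rightLeg h p) :=
  pa.rot_cutDown h h' p x

variable {x : P 2 ε} {p : P 1 ε}

theorem rot_corner_nonneg (hx : 0 ≤ pa.rot h x) (hp : IsStarProjection p) :
    0 ≤ pa.rot h (pa.corner h h' x p) := by
  rw [rot_corner]
  have := star_right_conjugate_nonneg hx (pa.leftLeg h p * pa.rightLeg h p)
  rwa [star_mul, pa.star_leftLeg, pa.star_rightLeg, hp.isSelfAdjoint.star_eq,
    ← pa.leftLeg_mul_rightLeg] at this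

theorem rightLeg_mul_rot_corner (hp : p * p = p) :
    pa.rightLeg h p * pa.rot h (pa.corner h h' x p) = pa.rot h (pa.corner h h' x p) := by
  rw [rot_corner, pa.leftLeg_mul_rightLeg]
  simp only [← mul_assoc]
  rw [← pa.rightLeg_mul, hp]

theorem rot_corner_mul_rightLeg (hp : p * p = p) :
    pa.rot h (pa.corner h h' x p) * pa.rightLeg h p = pa.rot h (pa.corner h h' x p) := by
  rw [rot_corner, mul_assoc, mul_assoc (pa.leftLeg h p) _ (pa.rightLeg h p), ← pa.rightLeg_mul, hp]

theorem leftLeg_mul_rot_corner (hp : p * p = p) :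
    pa.leftLeg h p * pa.rot h (pa.corner h h' x p) = pa.rot h (pa.corner h h' x p) := by
  rw [rot_corner]
  simp only [← mul_assoc]
  rw [← pa.leftLeg_mul, hp]

end CutDown

section Eigenvector

variable {x : P 2 ε} {y₀ p g k : P 1 ε} {r : ℝ} (hx : 0 ≤ pa.rot h x) (hr : 0 ≤ r)
  (hy₀ : IsPolarData y₀ p g k) (hy₀r : pa.act x y₀ = (r : ℂ) • y₀)

include h' hx hy₀ hy₀r in
/-- The corner cut out by the support of an eigenvector is invariant. -/
theorem act_mem_corner {y : P 1 ε} (hy : 0 ≤ y) (hpy : p * y * p = y) :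
    p * pa.act x y = pa.act x y ∧ pa.act x y * p = pa.act x y := by
  obtain ⟨c, _, hcy⟩ := hy₀.exists_le_smul (.of_nonneg hy) hpy
  have h1 := pa.act_mono h h' hx hcy
  rw [pa.act_real_smul, hy₀r, Complex.coe_smul, smul_smul] at h1
  exact mul_eq_self_of_le_smul hy₀.proj (pa.act_nonneg h h' hx hy) h1 hy₀.proj_mul

include hx hy₀ hy₀r in
theorem act_corner_eq {y : P 1 ε} (hy : 0 ≤ y) (hpy : p * y * p = y) :
    pa.act (pa.corner h h' x p) y = pa.act x y := by
  obtain ⟨h1, h2⟩ := pa.act_mem_corner h h' hx hy₀ hy₀r hy hpy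
  rw [act_corner, hpy, h1, h2]

include hx hy₀ hy₀r in
theorem act_corner_eigenvector :
    pa.act (pa.corner h h' x p) y₀ = (r : ℂ) • y₀ := by
  rw [pa.act_corner_eq h h' hx hy₀ hy₀r (isPos_iff.1 hy₀.isPos), hy₀r]
  rw [hy₀.proj_mul, hy₀.mul_proj]

include hx hy₀ hy₀r in
theorem exists_norm_corner_pow_le (hr' : 0 < r) :
    ∃ C : ℝ, ∀ j, ‖pa.corner h h' x p ^ j‖ ≤ C * r ^ j := by
  set xp := pa.corner h h' x p with hxp
  have hw : 0 ≤ pa.rot h xp := pa.rot_corner_nonneg h h' hx hy₀.proj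
  have hstep (j : ℕ) : pa.rot h (xp ^ (j + 1)) = pa.conv (pa.rot h (xp ^ j)) (pa.rot h xp) := by
    rw [pa.conv_rot_rot, pow_succ]
  -- The rotated corner is bounded by a multiple of `1 ⊗ p`, hence of `1 ⊗ y₀`. Each further
  -- convolution multiplies `1 ⊗ y₀` by exactly `r`.
  obtain ⟨c, hc, hcw⟩ : ∃ c : ℝ, 0 ≤ c ∧ pa.rot h xp ≤ c • pa.rightLeg h y₀ := by
    have h1 := CStarAlgebra.star_left_conjugate_le_norm_smul (a := pa.rightLeg h p)
      (IsSelfAdjoint.of_nonneg hw)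
    rw [pa.star_rightLeg, hy₀.star_proj, pa.rightLeg_mul_rot_corner h h' hy₀.proj_mul_proj,
      pa.rot_corner_mul_rightLeg h h' hy₀.proj_mul_proj, ← pa.rightLeg_mul,
      hy₀.proj_mul_proj] at h1
    refine ⟨‖pa.rot h xp‖ * ‖k * k‖, by positivity, h1.trans ?_⟩
    rw [mul_smul]
    refine smul_le_smul_of_nonneg_left ?_ (norm_nonneg _)
    refine (pa.rightLeg_mono h hy₀.proj_le).trans_eq ?_
    rw [← Complex.coe_smul, map_smul, Complex.coe_smul]
  have hmain (j : ℕ) : 0 ≤ pa.rot h (xp ^ (j + 1)) ∧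
      pa.rot h (xp ^ (j + 1)) ≤ (c * r ^ j) • pa.rightLeg h y₀ := by
    induction j with
    | zero => simpa using ⟨hw, hcw⟩
    | succ j ih =>
      rw [hstep (j + 1)]
      refine ⟨pa.conv_nonneg ih.1 hw, (pa.conv_mono ih.2 hw).trans_eq ?_⟩
      rw [pa.conv_real_smul, pa.conv_rightLeg, pa.act_corner_eigenvector h h' hx hy₀ hy₀r, map_smul,
        Complex.coe_smul, smul_smul, pow_succ, mul_assoc]
  have hfd := pa.finiteDimensional
  set L := LinearMap.toContinuousLinearMap (pa.rotInv (n := 1) h')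
  -- The norm of `1` covers the power `j = 0`, which the convolution estimate does not reach.
  refine ⟨max ‖(1 : P 2 ε)‖ (‖L‖ * (c * ‖pa.rightLeg h y₀‖) / r), fun j => ?_⟩
  cases j with
  | zero => simp
  | succ j =>
    have h1 := CStarAlgebra.norm_le_norm_of_nonneg_of_le (hmain j).1 (hmain j).2
    rw [norm_smul, Real.norm_of_nonneg (by positivity)] at h1
    have h2 : xp ^ (j + 1) = L (pa.rot h (xp ^ (j + 1))) :=
      (pa.rotInv_rot h h' (xp ^ (j + 1))).symm
    calc ‖xp ^ (j + 1)‖ ≤ ‖L‖ * ‖pa.rot h (xp ^ (j + 1))‖ := by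
          conv_lhs => rw [h2]
          exact L.le_opNorm _
      _ ≤ ‖L‖ * (c * r ^ j * ‖pa.rightLeg h y₀‖) := by gcongr
      _ = ‖L‖ * (c * ‖pa.rightLeg h y₀‖) / r * r ^ (j + 1) := by field_simp; ring
      _ ≤ _ := by gcongr; exact le_max_right _ _

include hx hy₀ hy₀r in
-- If the map of `x_p` kills `y₀ = g g*`, faithfulness of the partial closure gives `L(g) x̂_p = 0`.
-- Inverting `g` on its support leaves `x̂_p = 0`.
theorem corner_eq_zero (hr0 : r = 0) : pa.corner h h' x p = 0 := by
  apply pa.rot_injective h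
  have hw : 0 ≤ pa.rot h (pa.corner h h' x p) := pa.rot_corner_nonneg h h' hx hy₀.proj
  have h1 := pa.act_corner_eigenvector h h' hx hy₀ hy₀r
  rw [hr0, Complex.ofReal_zero, zero_smul] at h1
  have h2 := pa.leftLeg_mul_rot_eq_zero h h' hw (c := g)
    (by rw [hy₀.star_sqrt, hy₀.sqrt_mul_sqrt]; exact h1)
  rw [map_zero, ← pa.leftLeg_mul_rot_corner h h' hy₀.proj_mul_proj, ← hy₀.sqrt_mul_inv,
    pa.leftLeg_mul, mul_assoc]
  rw [hy₀.sqrt_mul_inv, h2, mul_zero]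

include hx hr hy₀ hy₀r in
theorem exists_abel_mean : ∃ (S : ℝ → P 2 ε) (yp : P 2 ε),
    (∀ z : ℝ, r < z →
      HasSum (fun j : ℕ => ((z : ℂ) ^ (j + 1))⁻¹ • (pa.corner h h' x p) ^ j) (S z)) ∧
    Tendsto (fun z : ℝ => ((z - r : ℝ) : ℂ) • S z) (𝓝[>] r) (𝓝 yp) := by
  rcases hr.eq_or_lt with hr0 | hr0
  -- For `r = 0` only the term `j = 0` survives, so the limit is `1`.
  · rw [pa.corner_eq_zero h h' hx hy₀ hy₀r hr0.symm]
    refine ⟨fun z => (z : ℂ)⁻¹ • 1, 1, fun z _ => ?_, ?_⟩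
    · convert hasSum_single (f := fun j : ℕ => ((z : ℂ) ^ (j + 1))⁻¹ • (0 : P 2 ε) ^ j) 0
        (fun j hj => by simp [hj]) using 1
      simp
    · refine tendsto_const_nhds.congr' ?_
      filter_upwards [self_mem_nhdsWithin] with z hz
      have hz' : (z : ℂ) ≠ 0 := by
        rw [← hr0] at hz
        exact_mod_cast (ne_of_gt hz)
      rw [← hr0, sub_zero, smul_smul, mul_inv_cancel₀ hz', one_smul]
  · have hfd := pa.finiteDimensional
    obtain ⟨C, hC⟩ := pa.exists_norm_corner_pow_le h h' hx hy₀ hy₀r hr0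
    exact exists_tendsto_abel_mean hr0 hC

section AbelMean

variable {S : ℝ → P 2 ε} {yp : P 2 ε}
  (hS : ∀ z : ℝ, r < z →
      HasSum (fun j : ℕ => ((z : ℂ) ^ (j + 1))⁻¹ • (pa.corner h h' x p) ^ j) (S z))
  (hyp : Tendsto (fun z : ℝ => ((z - r : ℝ) : ℂ) • S z) (𝓝[>] r) (𝓝 yp))

theorem continuous_actLeft (y : P 1 ε) : Continuous (pa.actLeft y) := by
  have hfd := pa.finiteDimensional
  exact LinearMap.continuous_of_finiteDimensional _

include hyp in
theorem tendsto_act_abel_mean (y : P 1 ε) :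
    Tendsto (fun z : ℝ => ((z - r : ℝ) : ℂ) • pa.act (S z) y) (𝓝[>] r) (𝓝 (pa.act yp y)) := by
  have h1 := ((pa.continuous_actLeft y).tendsto yp).comp hyp
  exact h1.congr fun z => (pa.actLeft y).map_smul _ _

include hS hyp hx hy₀ hr in
theorem act_abel_mean_nonneg {y : P 1 ε} (hy : 0 ≤ y) : 0 ≤ pa.act yp y := by
  have hw : 0 ≤ pa.rot h (pa.corner h h' x p) := pa.rot_corner_nonneg h h' hx hy₀.proj
  refine CStarAlgebra.isClosed_nonneg.mem_of_tendsto (pa.tendsto_act_abel_mean hyp y) ?_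
  filter_upwards [self_mem_nhdsWithin] with z hz
  have h1 := (hS z hz).map (pa.actLeft y) (pa.continuous_actLeft y)
  have h2 : 0 ≤ pa.act (S z) y := by
    refine CStarAlgebra.isClosed_nonneg.mem_of_tendsto h1 (.of_forall fun s => ?_)
    change (0 : P 1 ε) ≤ _
    refine Finset.sum_nonneg fun j _ => ?_
    have h3 : (((z : ℂ) ^ (j + 1))⁻¹) = (((z ^ (j + 1))⁻¹ : ℝ) : ℂ) := by push_cast; rfl
    rw [Function.comp_apply, map_smul, h3, Complex.coe_smul, pa.actLeft_apply]
    exact smul_nonneg (by have := hr.trans_lt hz; positivity)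
      (pa.act_pow_nonneg h h' hw j hy)
  show 0 ≤ _
  rw [Complex.coe_smul]
  exact smul_nonneg (sub_pos.2 hz).le h2

include hS hyp hx hy₀ hy₀r hr in
-- On `y₀` the resolvent acts as division by `z - r`, which the normalisation cancels.
theorem act_abel_mean_eigenvector : pa.act yp y₀ = y₀ := by
  refine tendsto_nhds_unique (pa.tendsto_act_abel_mean hyp y₀) (tendsto_const_nhds.congr' ?_)
  filter_upwards [self_mem_nhdsWithin] with z hz
  have hz0 : (z : ℂ) ≠ 0 := by exact_mod_cast (hr.trans_lt hz).ne'
  have h1 := congrArg (pa.actLeft y₀) (mul_eq_of_hasSum hz0 (hS z hz)).1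
  rw [map_sub, map_smul, pa.actLeft_apply, pa.actLeft_apply, pa.actLeft_apply, pa.act_mul,
    pa.act_corner_eigenvector h h' hx hy₀ hy₀r, pa.act_smul_right, pa.act_one_left] at h1
  rw [Complex.ofReal_sub, sub_smul, h1]
  abel

include hS hyp hr in
theorem abel_mean_mul_corner : yp * pa.corner h h' x p = (r : ℂ) • yp := by
  have h1 : Tendsto (fun z : ℝ => (z : ℂ)) (𝓝[>] r) (𝓝 (r : ℂ)) :=
    (Complex.continuous_ofReal.tendsto r).mono_left nhdsWithin_le_nhds
  have h2 : Tendsto (fun z : ℝ => ((z - r : ℝ) : ℂ)) (𝓝[>] r) (𝓝 0) := by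
    simpa using h1.sub_const (r : ℂ)
  have h3 := (h1.smul hyp).sub (h2.smul_const (1 : P 2 ε))
  rw [zero_smul, sub_zero] at h3
  refine tendsto_nhds_unique (hyp.mul_const _) (h3.congr' ?_)
  filter_upwards [self_mem_nhdsWithin] with z hz
  have hz0 : (z : ℂ) ≠ 0 := by exact_mod_cast (hr.trans_lt hz).ne'
  rw [smul_mul_assoc, (mul_eq_of_hasSum hz0 (hS z hz)).2, smul_sub, smul_comm]

include hS hyp hr in
theorem act_corner_abel_mean (y : P 1 ε) :
    pa.act (pa.corner h h' x p) (pa.act yp y) = (r : ℂ) • pa.act yp y := by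
  rw [← pa.act_mul, pa.abel_mean_mul_corner h h' hr hS hyp, ← pa.actLeft_apply, map_smul,
    pa.actLeft_apply]

include hS hyp hr hx hy₀ hy₀r in
/-- The Abel mean applied to the support projection of an eigenvector is an eigenvector with the
same support. -/
theorem exists_isPolarData_abel_mean : ∃ g' k', IsPolarData (pa.act yp p) p g' k' := by
  have hfd := pa.finiteDimensional
  have hpos {y : P 1 ε} (hy : 0 ≤ y) := pa.act_abel_mean_nonneg h h' hx hr hy₀ hS hyp hy
  have hfix := pa.act_abel_mean_eigenvector h h' hx hr hy₀ hy₀r hS hyp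
  have hmono {y z : P 1 ε} (hyz : y ≤ z) : pa.act yp y ≤ pa.act yp z := by
    rw [← sub_nonneg, ← pa.act_sub_right]
    exact hpos (sub_nonneg.2 hyz)
  -- `p` and `y₀` dominate multiples of each other. The map of `yp` preserves order and fixes `y₀`,
  -- so the image of `p` is comparable with `y₀` in the same way.
  have h1 := hmono hy₀.proj_le
  rw [pa.act_real_smul, hfix] at h1
  have h2 : y₀ ≤ ‖y₀‖ • p := le_norm_smul_of_corner hy₀.proj (.of_nonneg (isPos_iff.1 hy₀.isPos))
    (by rw [hy₀.proj_mul, hy₀.mul_proj])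
  have h3 := hmono h2
  rw [pa.act_real_smul, hfix] at h3
  obtain ⟨q, g', k', hq⟩ := exists_isPolarData (isPos_iff.2 (hpos hy₀.proj.nonneg))
  obtain rfl := hy₀.proj_eq_of_le hq h3 h1
  exact ⟨g', k', hq⟩

include hS hyp hr hx hy₀ hy₀r in
theorem act_abel_mean : pa.act x (pa.act yp p) = (r : ℂ) • pa.act yp p := by
  obtain ⟨g', k', hζ⟩ := pa.exists_isPolarData_abel_mean h h' hx hr hy₀ hy₀r hS hyp
  rw [← pa.act_corner_eq h h' hx hy₀ hy₀r (isPos_iff.1 hζ.isPos) (by rw [hζ.proj_mul, hζ.mul_proj]),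
    pa.act_corner_abel_mean h h' hr hS hyp]

end AbelMean

end Eigenvector

end CStarPlanarAlgebra

/-! ### The largest support and the functional of a right eigenvector -/

namespace CStarPlanarAlgebra

variable {P : ℕ → Bool → Type u} [∀ n ε, CStarAlgebra (P n ε)] (pa : CStarPlanarAlgebra P)
  {ε δ : Bool} (h : shade δ 1 = ε) (h' : shade ε 1 = δ)

attribute [local instance] CStarAlgebra.spectralOrder CStarAlgebra.spectralOrderedRing

/-- There is a positive eigenvector whose support contains the support of any other one. -/
theorem exists_max_support (x : P 2 ε) (r : ℝ) :
    ∃ y₀ p g k : P 1 ε, IsPolarData y₀ p g k ∧ pa.act x y₀ = (r : ℂ) • y₀ ∧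
      ∀ y q : P 1 ε, IsPos y → pa.act x y = (r : ℂ) • y → IsRangeProjection y q → p * q = q := by
  have hfd := pa.finiteDimensional
  set E : Set (P 1 ε) := {y | IsPos y ∧ pa.act x y = (r : ℂ) • y}
  -- Rank measures the size of the support. If it is maximal at `y₀`, adding another eigenvector
  -- cannot enlarge the support.
  set f : P 1 ε → ℕ := fun y => Module.finrank ℂ (LinearMap.range (LinearMap.mulLeft ℂ y))
  have hne : (f '' E).Nonempty := by
    refine ⟨_, 0, ⟨isPos_zero, ?_⟩, rfl⟩
    simpa using pa.act_smul_right x 0 0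
  have hbdd : BddAbove (f '' E) :=
    ⟨Module.finrank ℂ (P 1 ε), by rintro _ ⟨y, _, rfl⟩; exact Submodule.finrank_le _⟩
  obtain ⟨y₀, hy₀E, hy₀⟩ := Nat.sSup_mem hne hbdd
  have hmax : ∀ y ∈ E, f y ≤ f y₀ := fun y hy => by
    rw [hy₀]; exact le_csSup hbdd ⟨y, hy, rfl⟩
  obtain ⟨p, g, k, hp⟩ := exists_isPolarData hy₀E.1
  refine ⟨y₀, p, g, k, hp, hy₀E.2, fun y q hy hyr hq => ?_⟩
  have hsE : y₀ + y ∈ E := by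
    refine ⟨isPos_iff.2 (add_nonneg (isPos_iff.1 hy₀E.1) (isPos_iff.1 hy)), ?_⟩
    rw [pa.act_add_right, hy₀E.2, hyr, smul_add]
  obtain ⟨t, g', k', ht⟩ := exists_isPolarData hsE.1
  have h1 : t * y₀ = y₀ := (mul_eq_self_of_le_smul (c := 1) ht.proj (isPos_iff.1 hy₀E.1)
    (by rw [one_smul]; exact le_add_of_nonneg_right (isPos_iff.1 hy)) ht.proj_mul).1
  have h2 : t * y = y := (mul_eq_self_of_le_smul (c := 1) ht.proj (isPos_iff.1 hy)
    (by rw [one_smul]; exact le_add_of_nonneg_left (isPos_iff.1 hy₀E.1)) ht.proj_mul).1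
  -- The support `t` of the sum fixes `y₀`, and `k' * k'` inverts the sum on `t`; this provides the
  -- preimage.
  have h3 : LinearMap.range (LinearMap.mulLeft ℂ y₀) ≤
      LinearMap.range (LinearMap.mulLeft ℂ (y₀ + y)) := by
    rintro _ ⟨u, rfl⟩
    refine ⟨k' * k' * (y₀ * u), ?_⟩
    rw [LinearMap.mulLeft_apply, LinearMap.mulLeft_apply, ← mul_assoc, ht.mul_inv_mul_inv,
      ← mul_assoc, h1]
  have h4 := Submodule.eq_of_le_of_finrank_le h3 (hmax _ hsE)
  have h5 : y₀ + y ∈ LinearMap.range (LinearMap.mulLeft ℂ y₀) := by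
    rw [h4]; exact ⟨1, mul_one _⟩
  obtain ⟨u, hu⟩ := h5
  have h6 : p * (y₀ + y) = y₀ + y := by
    rw [← hu, LinearMap.mulLeft_apply, ← mul_assoc, hp.proj_mul]
  have h7 : p * t = t := ht.isRangeProjection.2.2 p hp.proj h6
  have h8 : t * q = q := hq.2.2 t ht.proj h2
  rw [← h8, ← mul_assoc, h7]

include h h' in
-- With respect to the trace, the adjoint of `y ↦ y ∗ x̂` is, up to rotation by 180 degrees, `y ↦ x̂
-- ∗ y`. So a right eigenvector gives an eigenfunctional.
theorem tr_act_mul {x : P 2 ε} {r : ℝ} {y₁ : P 1 δ}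
    (hy₁ : pa.cap (n := 1) 1 (by omega) (pa.cap (n := 2) 1 (by omega)
      (pa.ins (m := 2) (n := 1) (k := 3) 2 (by omega) rfl (shade_two_mul δ 1)
        (pa.rot (n := 1) h x) y₁)) = (r : ℂ) • y₁) (y : P 1 ε) :
    pa.tr 1 ε (pa.act x y * pa.rot (n := 0) h' y₁) =
      (r : ℂ) * pa.tr 1 ε (y * pa.rot (n := 0) h' y₁) := by
  rw [tr_apply, pa.closure_act_mul, ← tr_apply]
  have h1 := pa.rot_convolution h x (pa.rot (n := 0) h' y₁)
  rw [pa.rot_rot h' h, hy₁] at h1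
  have h2 := congrArg (pa.rot (n := 0) h') h1
  rw [pa.rot_rot h h', map_smul] at h2
  rw [← h2, mul_smul_comm, map_smul, smul_eq_mul]

include h in
/-- A positive 1-box below `p` on which the functional given by `y₁` vanishes is zero if `p` does
not meet the kernel of `y₁`. -/
theorem eq_zero_of_tr_mul_eq_zero {p s : P 1 ε} {y₁ q : P 1 δ} (hy₁ : IsPos y₁)
    (hq : IsRangeProjection y₁ q) (hinf : IsProjectionInf p (1 - pa.rot (n := 0) h' q) 0)
    (hs : 0 ≤ s) (hps : p * s = s) (htr : pa.tr 1 ε (s * pa.rot (n := 0) h' y₁) = 0) : s = 0 := by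
  have hfd := pa.finiteDimensional
  obtain ⟨b, hb⟩ := hy₁
  obtain ⟨c, hc⟩ := isPos_iff.2 hs
  obtain ⟨e, g, k, he⟩ := exists_isPolarData (isPos_iff.2 hs)
  set B : P 1 ε := pa.rot (n := 0) h' b with hB
  set t : P 1 ε := pa.rot (n := 0) h' y₁ with ht
  have htb : t = star B * B := by rw [ht, hb, pa.rot_mul, hB, pa.star_rot_one_box]
  -- By traciality the vanishing trace is that of `(B c) (B c)*`.
  have h1 : B * c = 0 := by
    apply pa.eq_zero_of_tr_mul_star_self
    calc _ = pa.tr 1 ε (B * (c * star c * star B)) := by rw [star_mul]; simp only [mul_assoc]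
      _ = pa.tr 1 ε (c * star c * star B * B) := pa.tr_mul_comm _ _
      _ = 0 := by rw [← htr, htb, hc, mul_assoc]
  have h2 : t * e = 0 := by
    rw [← he.mul_inv_mul_inv, hc, htb, ← mul_assoc, ← mul_assoc (star B * B),
      mul_assoc (star B), h1]
    simp
  -- Since `t` kills the support `e` of `s`, the rotated complement of `e` dominates the range `q`
  -- of `y₁`. Thus `e` lies below both `p` and the complement of the rotated `q`, and is zero.
  have h3 : pa.rot (n := 0) h (1 - e) * y₁ = y₁ := by
    have h4 : t * (1 - e) = t := by rw [mul_sub, h2, mul_one, sub_zero]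
    have h5 := congrArg (pa.rot (n := 0) h) h4
    rwa [pa.rot_mul, ht, pa.rot_rot] at h5
  have hf : IsStarProjection (pa.rot (n := 0) h (1 - e)) := by
    have h6 := he.proj.one_sub
    refine ⟨?_, ?_⟩
    · rw [IsIdempotentElem, ← pa.rot_mul, h6.isIdempotentElem]
    · rw [IsSelfAdjoint, pa.star_rot_one_box, h6.isSelfAdjoint.star_eq]
  have h7 := congrArg (pa.rot (n := 0) h') (hq.2.2 _ hf h3)
  rw [pa.rot_mul, pa.rot_rot, mul_sub, mul_one, sub_eq_self] at h7
  have h8 : p * e = e := by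
    rw [← he.mul_inv_mul_inv, ← mul_assoc, hps]
  have h9 := hinf.2.2.2 e he.proj h8 (by rw [sub_mul, one_mul, h7, sub_zero])
  rw [zero_mul] at h9
  rw [← he.proj_mul, ← h9, zero_mul]

/-! ### Exchange relations after rotation -/

section Exchange

variable {x : P 2 ε}

/-- Rotation carries a factor above and a factor below the right string to the same side of `x̂`,
one on each leg. For the left string the factors land on the other side of `x̂`, whence the adjoint
in the next lemma. -/
theorem exchange_right_iff {v : P 1 ε} :
    x * pa.juxt h' 1 (pa.rot (n := 0) h v) = pa.juxt h' 1 (pa.rot (n := 0) h v) * x ↔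
      pa.rightLeg h v * pa.rot h x = pa.leftLeg h v * pa.rot h x := by
  rw [← (pa.rot_injective (n := 1) h).eq_iff, pa.rot_mul_juxt_rot_right, pa.rot_juxt_rot_right_mul]

theorem exchange_left_iff (hx : 0 ≤ pa.rot h x) {v : P 1 ε} :
    x * pa.juxt h' v 1 = pa.juxt h' v 1 * x ↔
      pa.rightLeg h (star v) * pa.rot h x = pa.leftLeg h (star v) * pa.rot h x := by
  rw [← (pa.rot_injective (n := 1) h).eq_iff, pa.rot_mul_juxt_left, pa.rot_juxt_left_mul,
    ← star_inj, star_mul, star_mul, pa.star_rightLeg, pa.star_leftLeg,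
    (IsSelfAdjoint.of_nonneg hx).star_eq]

include h' in
-- A factor on the left leg enters the argument of the map, and a factor on the right leg leaves the
-- closure as an outer factor. Exchangeability identifies the two.
theorem act_mul_of_exchange (hx : 0 ≤ pa.rot h x) {v : P 1 ε}
    (hv : pa.rightLeg h v * pa.rot h x = pa.leftLeg h v * pa.rot h x) (z : P 1 ε) :
    pa.act x (v * z * star v) = v * pa.act x z * star v := by
  have hv' := congrArg star hv
  rw [star_mul, star_mul, pa.star_rightLeg, pa.star_leftLeg,
    (IsSelfAdjoint.of_nonneg hx).star_eq] at hv'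
  have h1 (z : P 1 ε) : pa.act x (v * z) = v * pa.act x z := by
    rw [← pa.closeLeft_mul_leftLeg h h', pa.leftLeg_mul, ← mul_assoc, ← pa.closeLeft_leftLeg_comm h,
      ← mul_assoc, ← hv, mul_assoc, pa.closeLeft_rightLeg_mul h h', pa.closeLeft_mul_leftLeg]
  have h2 (z : P 1 ε) : pa.act x (z * star v) = pa.act x z * star v := by
    rw [← pa.closeLeft_leftLeg_mul h h', pa.leftLeg_mul, mul_assoc, pa.closeLeft_leftLeg_comm h,
      mul_assoc, ← hv', ← mul_assoc, pa.closeLeft_mul_rightLeg h h', pa.closeLeft_leftLeg_mul]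
  rw [h2, h1]

/-- The 1-boxes that can be exchanged form an algebra. -/
theorem exchange_polynomial {w : P 2 δ} {p g k a : P 1 ε} (hgk : g * k = p) (hkg : k * g = p)
    (hpa : p * a = a) (hrp : pa.rightLeg h p * w = w) (hlp : pa.leftLeg h p * w = w)
    (ha : pa.rightLeg h (g * a * k) * w = pa.leftLeg h (g * a * k) * w) (f : Polynomial ℝ) :
    pa.rightLeg h (g * Polynomial.aeval a f * k) * w =
      pa.leftLeg h (g * Polynomial.aeval a f * k) * w := by
  induction f using Polynomial.induction_on' with
  | add f f' hf hf' => simp only [map_add, mul_add, add_mul, hf, hf']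
  | monomial n c =>
    have hpow : pa.rightLeg h (g * a ^ n * k) * w = pa.leftLeg h (g * a ^ n * k) * w := by
      induction n with
      | zero => rw [pow_zero, mul_one, hgk, hrp, hlp]
      | succ n ih =>
        have h1 : g * a ^ (n + 1) * k = (g * a ^ n * k) * (g * a * k) := by
          rw [pow_succ]
          simp only [mul_assoc]
          rw [← mul_assoc k g, hkg, ← mul_assoc p, hpa]
        -- The right leg preserves products, the left leg reverses them, and the legs commute: `R(b)
        -- R(c) w = R(b) L(c) w = L(c) R(b) w = L(c) L(b) w`.
        rw [h1, pa.rightLeg_mul, pa.leftLeg_mul, mul_assoc, ha, ← mul_assoc,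
          ← pa.leftLeg_mul_rightLeg, mul_assoc, ih]
        simp only [mul_assoc]
    rw [Polynomial.aeval_monomial, ← Algebra.smul_def, mul_smul_comm, smul_mul_assoc,
      ← Complex.coe_smul, map_smul, map_smul, smul_mul_assoc, smul_mul_assoc, hpow]

end Exchange

/-! ### Eigenvectors and exchangeable elements -/

section Main

variable {x : P 2 ε} {ζ p g k : P 1 ε} {r : ℝ} (hx : 0 ≤ pa.rot h x)
  (hζ : IsPolarData ζ p g k) (hζr : pa.act x ζ = (r : ℂ) • ζ)

include hx hζ hζr in
/-- If `y` is an eigenvector below `p`, then `y * ζ⁻¹` can be exchanged. -/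
theorem exchange_of_eigenvector {y y₁ : P 1 ε}
    (hvanish : ∀ s : P 1 ε, 0 ≤ s → p * s = s → pa.tr 1 ε (s * y₁) = 0 → s = 0)
    (htr : ∀ z, pa.tr 1 ε (pa.act x z * y₁) = (r : ℂ) * pa.tr 1 ε (z * y₁))
    (hy : 0 ≤ y) (hpy : p * y = y) (hyr : pa.act x y = (r : ℂ) • y) :
    pa.rightLeg h (y * (k * k)) * pa.rot h (pa.corner h h' x p) =
      pa.leftLeg h (y * (k * k)) * pa.rot h (pa.corner h h' x p) := by
  obtain ⟨m, hm⟩ := isPos_iff.2 hx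
  have hys : star y = y := hy.isSelfAdjoint
  have hyp : y * p = y := by
    simpa [hys, hζ.star_proj] using congrArg star hpy
  set d := y * (k * k) with hd
  have hds : star d = k * k * y := by rw [hd, star_mul, star_mul, hζ.star_inv, hys]
  have hpd : p * d = d := by rw [hd, ← mul_assoc, hpy]
  have hdp : d * p = d := by rw [hd, mul_assoc, mul_assoc, hζ.inv_mul_proj]
  have hkkζ : k * k * ζ = p := by
    rw [← hζ.sqrt_mul_sqrt, mul_assoc, ← mul_assoc k g, hζ.inv_mul_sqrt, hζ.proj_mul_sqrt,
      hζ.inv_mul_sqrt]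
  have hdζ : d * ζ = y := by rw [hd, mul_assoc, hkkζ, hyp]
  have hζd : ζ * star d = y := by rw [hds, ← mul_assoc, hζ.mul_inv_mul_inv, hpy]
  set z := y * star d with hz
  have hdy : d * y = z := by rw [hz, hd, hds, mul_assoc]
  have hz0 : 0 ≤ z := by
    rw [hz, hds]
    have := mul_star_self_nonneg (y * k)
    rwa [star_mul, hζ.star_inv, hys, mul_assoc, ← mul_assoc k] at this
  have hzp : p * z * p = z := by
    rw [hz, hds, ← mul_assoc, hpy, mul_assoc, mul_assoc (k * k), hyp]
  -- `U` measures the failure of `d` to be exchangeable, weighted by `ζ^{1/2}`. Of the four terms of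
  -- `U x̂ U*`, three close to `r z` and one to `act x z`.
  set U := pa.leftLeg h g * (pa.leftLeg h d - pa.rightLeg h d) with hU
  have hUs : star U = (pa.leftLeg h (star d) - pa.rightLeg h (star d)) * pa.leftLeg h g := by
    rw [hU, star_mul, star_sub, pa.star_leftLeg, pa.star_leftLeg, pa.star_rightLeg, hζ.star_sqrt]
  have hS : pa.closeLeft h' (U * pa.rot h x * star U) = pa.act x z - (r : ℂ) • z := by
    have e1 (b c : P 1 ε) : pa.closeLeft h' (pa.leftLeg h b * pa.rot h x * pa.leftLeg h c) =
        pa.act x (b * c) := by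
      rw [mul_assoc, pa.closeLeft_leftLeg_comm h h', mul_assoc, ← pa.leftLeg_mul,
        pa.closeLeft_mul_leftLeg h h']
    have e2 : U = pa.leftLeg h (d * g) - pa.rightLeg h d * pa.leftLeg h g := by
      rw [hU, mul_sub, ← pa.leftLeg_mul, pa.leftLeg_mul_rightLeg]
    have e3 : star U = pa.leftLeg h (g * star d) - pa.leftLeg h g * pa.rightLeg h (star d) := by
      rw [hUs, sub_mul, ← pa.leftLeg_mul, ← pa.leftLeg_mul_rightLeg]
    have hgg (a b : P 1 ε) : a * g * (g * b) = a * ζ * b := by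
      rw [mul_assoc, ← mul_assoc g, hζ.sqrt_mul_sqrt, mul_assoc]
    have t1 : pa.closeLeft h' (pa.leftLeg h (d * g) * pa.rot h x * pa.leftLeg h (g * star d)) =
        pa.act x z := by
      rw [e1, hgg, hdζ]
    have t2 : pa.closeLeft h' (pa.leftLeg h (d * g) * pa.rot h x *
        (pa.leftLeg h g * pa.rightLeg h (star d))) = (r : ℂ) • z := by
      rw [← mul_assoc, pa.closeLeft_mul_rightLeg h h', e1, mul_assoc, hζ.sqrt_mul_sqrt, hdζ, hyr,
        smul_mul_assoc]
    have t3 : pa.closeLeft h' (pa.rightLeg h d * pa.leftLeg h g * pa.rot h x *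
        pa.leftLeg h (g * star d)) = (r : ℂ) • z := by
      rw [mul_assoc, mul_assoc, pa.closeLeft_rightLeg_mul h h', ← mul_assoc, e1, ← mul_assoc,
        hζ.sqrt_mul_sqrt, hζd, hyr, mul_smul_comm, hdy]
    have t4 : pa.closeLeft h' (pa.rightLeg h d * pa.leftLeg h g * pa.rot h x *
        (pa.leftLeg h g * pa.rightLeg h (star d))) = (r : ℂ) • z := by
      rw [← mul_assoc, pa.closeLeft_mul_rightLeg h h', mul_assoc, mul_assoc,
        pa.closeLeft_rightLeg_mul h h', ← mul_assoc (pa.leftLeg h g), e1, hζ.sqrt_mul_sqrt, hζr,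
        mul_smul_comm, smul_mul_assoc, hdζ]
    rw [e3, e2, sub_mul, sub_mul, mul_sub, mul_sub, map_sub, map_sub, map_sub, t1, t2, t3, t4,
      sub_self, sub_zero]
  -- The closure is positive and below `p`, and the eigenfunctional vanishes on `act x z - r z`.
  have hS0 : pa.closeLeft h' (U * pa.rot h x * star U) = 0 := by
    refine hvanish _ (pa.closeLeft_nonneg h' (star_right_conjugate_nonneg hx U)) ?_ ?_
    · obtain ⟨h1, h2⟩ := pa.act_mem_corner h h' hx hζ hζr hz0 hzp
      rw [hS, mul_sub, h1, mul_smul_comm]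
      congr 2
      rw [← hzp]
      simp only [← mul_assoc, hζ.proj_mul_proj]
    · rw [hS, sub_mul, map_sub, htr, smul_mul_assoc, map_smul, smul_eq_mul, sub_self]
  have hUm : U * m = 0 := by
    rw [hm, ← mul_assoc, mul_assoc, ← star_mul] at hS0
    exact pa.eq_zero_of_closeLeft_mul_star h' hS0
  have hUx : U * pa.rot h x = 0 := by rw [hm, ← mul_assoc, hUm, zero_mul]
  -- Cancelling the weight `g` leaves a cut-down by `p` on the left leg only; the cut-down on the
  -- right leg is restored next.
  have h3 : pa.leftLeg h d * pa.rot h x = pa.rightLeg h d * pa.leftLeg h p * pa.rot h x := by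
    have h4 : pa.leftLeg h k * (U * pa.rot h x) = 0 := by rw [hUx, mul_zero]
    rw [hU, ← mul_assoc, ← mul_assoc, ← pa.leftLeg_mul, hζ.sqrt_mul_inv, mul_sub, ← pa.leftLeg_mul,
      hdp, pa.leftLeg_mul_rightLeg, sub_mul, sub_eq_zero] at h4
    exact h4
  have h5 : pa.rightLeg h d * (pa.leftLeg h p * pa.rightLeg h p * pa.rot h x) =
      pa.leftLeg h d * (pa.leftLeg h p * pa.rightLeg h p * pa.rot h x) := by
    calc _ = pa.rightLeg h p * (pa.rightLeg h d * pa.leftLeg h p * pa.rot h x) := by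
          rw [pa.leftLeg_mul_rightLeg]
          simp only [← mul_assoc]
          rw [← pa.rightLeg_mul, ← pa.rightLeg_mul, hdp, hpd]
      _ = pa.rightLeg h p * (pa.leftLeg h d * pa.rot h x) := by rw [h3]
      _ = _ := by
          simp only [← mul_assoc]
          rw [← pa.leftLeg_mul, hpd, pa.leftLeg_mul_rightLeg]
  rw [pa.rot_corner]
  simpa only [mul_assoc] using congrArg (· * (pa.leftLeg h p * pa.rightLeg h p)) h5

include hx hζ hζr in
/-- Every eigenvector below `p` is of the form `v * ζ * star v`, where `v` can be exchanged. -/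
theorem exists_exchange_of_eigenvector {y y₁ : P 1 ε}
    (hvanish : ∀ s : P 1 ε, 0 ≤ s → p * s = s → pa.tr 1 ε (s * y₁) = 0 → s = 0)
    (htr : ∀ z, pa.tr 1 ε (pa.act x z * y₁) = (r : ℂ) * pa.tr 1 ε (z * y₁))
    (hy : 0 ≤ y) (hpy : p * y = y) (hyr : pa.act x y = (r : ℂ) • y) :
    ∃ v, pa.rightLeg h v * pa.rot h (pa.corner h h' x p) =
      pa.leftLeg h v * pa.rot h (pa.corner h h' x p) ∧ y = v * ζ * star v := by
  have hfd := pa.finiteDimensional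
  have hd := pa.exchange_of_eigenvector h h' hx hζ hζr hvanish htr hy hpy hyr
  have hys : star y = y := hy.isSelfAdjoint
  have hyp : y * p = y := by
    simpa [hys, hζ.star_proj] using congrArg star hpy
  set a := k * y * k with ha
  have ha0 : IsPos a := by
    obtain ⟨c, hc⟩ := isPos_iff.2 hy
    refine ⟨k * c, ?_⟩
    rw [ha, hc, star_mul, hζ.star_inv]
    simp only [mul_assoc]
  have hpa : p * a = a := by rw [ha, ← mul_assoc, ← mul_assoc, hζ.proj_mul_inv]
  have hap : a * p = a := by rw [ha, mul_assoc, hζ.inv_mul_proj]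
  have hgak : g * a * k = y * (k * k) := by
    rw [ha, ← mul_assoc, ← mul_assoc, hζ.sqrt_mul_inv, hpy, mul_assoc]
  -- The exchange algebra is not known to be closed under adjoints, so the square root must be a
  -- polynomial and not merely an element of a `*`-subalgebra.
  obtain ⟨f, hfs, hff⟩ := exists_polynomial_sqrt ha0
  set b := Polynomial.aeval a f
  refine ⟨g * b * k, ?_, ?_⟩
  · refine pa.exchange_polynomial h hζ.sqrt_mul_inv hζ.inv_mul_sqrt hpa
      (pa.rightLeg_mul_rot_corner h h' hζ.proj_mul_proj)
      (pa.leftLeg_mul_rot_corner h h' hζ.proj_mul_proj) ?_ f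
    rw [hgak, hd]
  -- `f` may have a constant term; that `b` lies below `p` comes from `b * b = a`.
  · have h1 : (1 - p) * b = 0 := by
      apply mul_star_self_eq_zero
      rw [star_mul, hfs, mul_assoc, ← mul_assoc b, hff, star_sub, star_one, hζ.star_proj, mul_sub,
        mul_one, hap, sub_self, mul_zero]
    have hpb : p * b = b := by
      rw [sub_mul, one_mul, sub_eq_zero] at h1
      exact h1.symm
    have h2 : k * ζ * k = p := by
      rw [← hζ.sqrt_mul_sqrt, ← mul_assoc, hζ.inv_mul_sqrt, hζ.proj_mul_sqrt, hζ.sqrt_mul_inv]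
    calc y = p * y * p := by rw [hpy, hyp]
      _ = g * a * g := by
        rw [ha, ← hζ.inv_mul_sqrt]
        nth_rw 1 [hζ.inv_mul_sqrt, ← hζ.sqrt_mul_inv]
        simp only [mul_assoc]
      _ = g * b * (p * b) * g := by rw [hpb, mul_assoc g b b, hff]
      _ = g * b * (k * ζ * k) * (b * g) := by rw [h2]; simp only [mul_assoc]
      _ = _ := by
        rw [star_mul, star_mul, hfs, hζ.star_inv, hζ.star_sqrt]
        simp only [mul_assoc]

include hx hζ hζr in
/-- Conversely, exchangeable 1-boxes produce eigenvectors. -/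
theorem act_exchange (hr : 0 < r) {v : P 1 ε}
    (hv : pa.rightLeg h v * pa.rot h (pa.corner h h' x p) =
      pa.leftLeg h v * pa.rot h (pa.corner h h' x p)) :
    pa.act x (v * ζ * star v) = (r : ℂ) • (v * ζ * star v) := by
  set y := v * ζ * star v with hy
  have hy0 : 0 ≤ y := star_right_conjugate_nonneg (isPos_iff.1 hζ.isPos) v
  have h1 : pa.act (pa.corner h h' x p) y = (r : ℂ) • y := by
    rw [pa.act_mul_of_exchange h h' (pa.rot_corner_nonneg h h' hx hζ.proj) hv,
      pa.act_corner_eigenvector h h' hx hζ hζr, mul_smul_comm, smul_mul_assoc]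
  -- Nothing places `v` below `p`, but `y` is `r⁻¹` times its image under the map of the corner,
  -- which lies in the corner. This needs `r ≠ 0`.
  have h2 : p * y * p = y := by
    have hr' : (r : ℂ) ≠ 0 := by exact_mod_cast hr.ne'
    have h3 : y = (r : ℂ)⁻¹ • pa.act (pa.corner h h' x p) y := by
      rw [h1, smul_smul, inv_mul_cancel₀ hr', one_smul]
    rw [pa.act_corner] at h3
    rw [h3, mul_smul_comm, smul_mul_assoc]
    congr 1
    simp only [← mul_assoc, hζ.proj_mul_proj]
    rw [mul_assoc _ p p, hζ.proj_mul_proj]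
  rw [← h1, pa.act_corner_eq h h' hx hζ hζr hy0 h2]

include h h' hx in
/-- If the 2-box is nilpotent, then its action is zero. -/
theorem act_eq_zero_of_isNilpotent {y₁ : P 1 ε}
    (hvanish : ∀ s : P 1 ε, 0 ≤ s → p * s = s → pa.tr 1 ε (s * y₁) = 0 → s = 0)
    (htr : ∀ z, pa.tr 1 ε (pa.act x z * y₁) = 0)
    (hmax : ∀ y, 0 ≤ y → pa.act x y = 0 → p * y = y) (hnil : IsNilpotent x) {y : P 1 ε}
    (hy : 0 ≤ y) : pa.act x y = 0 := by
  obtain ⟨n, hn⟩ := hnil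
  -- Descent: if one more application gives zero, the previous iterate is in the kernel, hence below
  -- `p`. Being itself an image, it has zero pairing with `y₁`, so it vanishes.
  have key : ∀ n, pa.act (x ^ (n + 1)) y = 0 → pa.act x y = 0 := by
    intro n
    induction n with
    | zero => simp
    | succ n ih =>
      intro h0
      refine ih ?_
      rw [pow_succ, pa.act_mul] at h0
      refine hvanish _ (pa.act_pow_nonneg h h' hx _ hy)
        (hmax _ (pa.act_pow_nonneg h h' hx _ hy) h0) ?_
      rw [pow_succ, pa.act_mul, htr]
  exact key n (by rw [pow_succ, hn, zero_mul, pa.act_zero_left])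

end Main

end CStarPlanarAlgebra

/-! ### The structure theorem -/

theorem theorem5p12 {P : ℕ → Bool → Type u} [∀ n ε, CStarAlgebra (P n ε)]
    (pa : CStarPlanarAlgebra P) (ε : Bool) (x : P 2 ε) (hx : pa.FPositive x) :
    ∃ p ζ : P 1 ε, pa.IsMaxProjection x p ∧ pa.IsMaxSupportEigenvector x p ζ ∧
      ((∃ (y₁ q : P 1 (!ε)), pa.IsRightPFEigenvector x y₁ ∧ IsRangeProjection y₁ q ∧
          IsProjectionInf p (1 - pa.bar' q) 0) →
        pa.posEigenvectors x = {y | ∃ v ∈ pa.exchangeA (pa.cutDown x p), y = v * ζ * star v} ∧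
        pa.posEigenvectors x = {y | ∃ v ∈ pa.exchangeB (pa.cutDown x p), y = star v * ζ * v}) := by
  have hfd := pa.finiteDimensional
  have h := shade_not_one ε
  have h' := shade_one ε
  let (n : ℕ) (ε : Bool) := CStarAlgebra.spectralOrder (P n ε)
  have (n : ℕ) (ε : Bool) := CStarAlgebra.spectralOrderedRing (P n ε)
  set r := CStarPlanarAlgebra.specRad x with hrdef
  have hr : 0 ≤ r := ENNReal.toReal_nonneg
  have hx' : 0 ≤ pa.rot h x := isPos_iff.1 hx
  have hconv (y : P 1 ε) (z : P 2 ε) : pa.convLeft y (pa.fourier z) = pa.act z y :=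
    pa.convolution_rot h' h y z
  have hE (y : P 1 ε) : y ∈ pa.posEigenvectors x ↔ IsPos y ∧ pa.act x y = (r : ℂ) • y := by
    rw [← hconv]; rfl
  obtain ⟨y₀, p, g, k, hy₀, hy₀r, hmax⟩ := pa.exists_max_support x r
  obtain ⟨S, yp, hS, hyp⟩ := pa.exists_abel_mean h h' hx' hr hy₀ hy₀r
  obtain ⟨g', k', hζ⟩ := pa.exists_isPolarData_abel_mean h h' hx' hr hy₀ hy₀r hS hyp
  have hζr := pa.act_abel_mean h h' hx' hr hy₀ hy₀r hS hyp
  refine ⟨p, pa.act yp p, ⟨⟨y₀, (hE _).2 ⟨hy₀.isPos, hy₀r⟩, hy₀.isRangeProjection⟩,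
    fun y hy q hq => hmax y q ((hE y).1 hy).1 ((hE y).1 hy).2 hq⟩,
    ⟨S, yp, hS, hyp, (hconv p yp).symm⟩, ?_⟩
  rintro ⟨y₁, q, hy₁, hq, hinf⟩
  have hmax' (y : P 1 ε) (hy : IsPos y) (hyr : pa.act x y = (r : ℂ) • y) : p * y = y := by
    obtain ⟨e, _, _, he⟩ := exists_isPolarData hy
    rw [← he.proj_mul, ← mul_assoc, hmax y e hy hyr he.isRangeProjection]
  have htr := pa.tr_act_mul h h' (x := x) (r := r) (y₁ := y₁) hy₁.2.2
  have hvanish (s : P 1 ε) (hs : 0 ≤ s) (hps : p * s = s) :=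
    pa.eq_zero_of_tr_mul_eq_zero h h' hy₁.2.1 hq hinf hs hps
  have hA (v : P 1 ε) : v ∈ pa.exchangeA (pa.cutDown x p) ↔
      pa.rightLeg h v * pa.rot h (pa.corner h h' x p) =
        pa.leftLeg h v * pa.rot h (pa.corner h h' x p) := pa.exchange_right_iff h h'
  have hB (v : P 1 ε) : v ∈ pa.exchangeB (pa.cutDown x p) ↔
      star v ∈ pa.exchangeA (pa.cutDown x p) := by
    rw [hA]
    exact pa.exchange_left_iff h h' (pa.rot_corner_nonneg h h' hx' hy₀.proj)
  have hmain : pa.posEigenvectors x =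
      {y | ∃ v ∈ pa.exchangeA (pa.cutDown x p), y = v * pa.act yp p * star v} := by
    ext y
    rw [hE]
    constructor
    · rintro ⟨hy, hyr⟩
      obtain ⟨v, hv, hyv⟩ := pa.exists_exchange_of_eigenvector h h' hx' hζ hζr hvanish htr
        (isPos_iff.1 hy) (hmax' y hy hyr) hyr
      exact ⟨v, (hA v).2 hv, hyv⟩
    · rintro ⟨v, hv, rfl⟩
      have hpos : 0 ≤ v * pa.act yp p * star v :=
        star_right_conjugate_nonneg (isPos_iff.1 hζ.isPos) v
      refine ⟨isPos_iff.2 hpos, ?_⟩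
      -- For `r = 0` the corner is zero and every `v` is exchangeable, so the whole map must be
      -- shown to vanish on positive elements.
      rcases hr.eq_or_lt with hr0 | hr0
      · have hrad : spectralRadius ℂ x = 0 := by
          -- `toReal` also sends `⊤` to `0`, so finiteness has to be excluded as the source of `r =
          -- 0` by a norm bound.
          have h1 : spectralRadius ℂ x ≠ ⊤ := ne_top_of_le_ne_top
            (ENNReal.coe_ne_top (r := ‖x‖₊ * ‖(1 : P 2 ε)‖₊)) <| by
              simpa using spectrum.spectralRadius_le_pow_nnnorm_pow_one_div ℂ x 0
          have h2 : (spectralRadius ℂ x).toReal = 0 := hr0.symm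
          exact (ENNReal.toReal_eq_zero_iff _).1 h2 |>.resolve_right h1
        rw [← hr0, Complex.ofReal_zero, zero_smul]
        refine pa.act_eq_zero_of_isNilpotent h h' hx' hvanish (fun z => ?_) (fun y hy hy0 => ?_)
          (isNilpotent_of_spectralRadius_eq_zero hrad) hpos
        · rw [htr, ← hr0, Complex.ofReal_zero, zero_mul]
        · exact hmax' y (isPos_iff.2 hy) (by rw [hy0, ← hr0, Complex.ofReal_zero, zero_smul])
      · exact pa.act_exchange h h' hx' hζ hζr hr0 ((hA v).1 hv)
  refine ⟨hmain, hmain.trans ?_⟩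
  ext y
  constructor
  · rintro ⟨v, hv, rfl⟩
    exact ⟨star v, (hB _).2 (by rwa [star_star]), by rw [star_star]⟩
  · rintro ⟨v, hv, rfl⟩
    exact ⟨star v, (hB _).1 hv, by rw [star_star]⟩
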